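/- **Corollary (Mixed Time Encoding).** Fix $\Omega>0$ and $s_0\in\mathbb R$, put $t_k=k\pi/\Omega+s_0$ and $\operatorname{sinc}_\Omega(t)=\sin(\Omega t)/(\pi t)$ (with value $\Omega/\pi$ at $t=0$), and for $C=(c_{jk})\in\mathbb R^{J\times K}$ let $$x^{(j)}(t)=\sum_{k=1}^K c_{jk}\operatorname{sinc}_\Omega(t-t_k),\qquad j=1,\dots,J .$$ Let $A\in\mathbb R^{I\times J}$ be such that any $J$ of its rows are linearly independent, and let $y(t)=Ax(t)$. For $i=1,\dots,I$, let $y^{(i)}$ be sampled by an integrate-and-fire time encoding machine with parameters $\kappa^{(i)}>0$, $\delta^{(i)}>0$, $b^{(i)}\in\mathbb R$, started at time $t_0^{(i)}\in\mathbb R$: its $(\ell+1)$-st spike time $t^{(i)}_{\ell+1}$ is the first time $t>t^{(i)}_\ell$ at which $\int_{t^{(i)}_\ell}^{t}\big(y^{(i)}(u)+b^{(i)}\big)\,du=2\kappa^{(i)}\delta^{(i)}$. Fix $\Omega,s_0,A$ and all $\kappa^{(i)},b^{(i)},t_0^{(i)}$. Then for Lebesgue-almost every choice of the firing thresholds $(\delta^{(1)},\dots,\delta^{(I)})\in(0,\infty)^I$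 the following holds, whatever the law of the coefficients. If the $c_{jk}$ are independent random variables with Lipschitz-continuous distribution functions, then with probability one: whenever each machine $i$ emits (at least) $n^{(i)}_{\rm spikes}$ spikes, and $$\sum_{i=1}^I\min\big(n^{(i)}_{\rm spikes},K\big)\ \ge\ JK ,$$ the signal $x$ is perfectly recoverable from the first $n^{(i)}_{\rm spikes}$ spike times of the machines $i=1,\dots,I$; that is, $x$ is the only signal of the above form whose mixtures satisfy $\int_{t^{(i)}_\ell}^{t^{(i)}_{\ell+1}}\big(y^{(i)}(u)+b^{(i)}\big)\,du=2\kappa^{(i)}\delta^{(i)}$ for all $i$ and all $0\le\ell<n^{(i)}_{\rm spikes}$. (The counts $n^{(i)}_{\rm spikes}$ may depend on the realization.) -/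

import Mathlib

open MeasureTheory ProbabilityTheory

noncomputable section

namespace MixedTEM

/-- The kernel `sinc_Ω(t) = sin(Ω t) / (π t)`, with its continuous value `Ω / π` at `t = 0`. -/
def sincΩ (Ω t : ℝ) : ℝ := Ω / Real.pi * Real.sinc (Ω * t)

/-- The `j`-th component `x^(j)(t) = ∑_{k=1}^K c_{jk} sinc_Ω(t - t_k)`, `t_k = k π / Ω + s₀`.
The index `k : Fin K` stands for the number `k + 1`. -/
def signal {J K : ℕ} (Ω s₀ : ℝ) (C : Matrix (Fin J) (Fin K) ℝ) (j : Fin J) (t : ℝ) : ℝ :=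
  ∑ k : Fin K, C j k * sincΩ Ω (t - (((k : ℕ) + 1 : ℝ) * Real.pi / Ω + s₀))

/-- The mixed signals `y(t) = A x(t)`. -/
def mix {I J : ℕ} (A : Matrix (Fin I) (Fin J) ℝ) (x : Fin J → ℝ → ℝ) (i : Fin I) (t : ℝ) : ℝ :=
  ∑ j : Fin J, A i j * x j t

/-- The integrate-and-fire time encoding machine with parameters `κ, δ, b`, started at time `t₀`
with integrator value `-κ δ`, emits on the input `y` (at least) `n` spikes, and the first `n` of
them are `t 1 < ... < t n` (with `t 0 = t₀`): it fires whenever the integral of `y + b` since the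
last reset first reaches `2 κ δ`. The values `t ℓ` for `n < ℓ` are irrelevant. -/
def EmitsSpikes (κ δ b t₀ : ℝ) (y : ℝ → ℝ) (n : ℕ) (t : ℕ → ℝ) : Prop :=
  t 0 = t₀ ∧ ∀ l < n, t l < t (l + 1) ∧
    (∫ u in (t l)..(t (l + 1)), (y u + b)) = 2 * κ * δ ∧
    ∀ s, t l < s → s < t (l + 1) → (∫ u in (t l)..s, (y u + b)) < 2 * κ * δ

/-- The signal with coefficients `C` is perfectly recoverable from the spike times `t i l`
(`l ≤ n i`): it is the only signal of the model whose mixtures have the recorded integrals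
`∫_{t_l}^{t_{l+1}} (y^(i) + b^(i)) = 2 κ^(i) δ^(i)`. In particular it is the only one for which
the machines emit these spikes. -/
def PerfectlyRecoverable {I J K : ℕ} (Ω s₀ : ℝ) (A : Matrix (Fin I) (Fin J) ℝ)
    (κ δ b : Fin I → ℝ) (n : Fin I → ℕ) (t : Fin I → ℕ → ℝ)
    (C : Matrix (Fin J) (Fin K) ℝ) : Prop :=
  ∀ C' : Matrix (Fin J) (Fin K) ℝ,
    (∀ i, ∀ l < n i, (∫ u in (t i l)..(t i (l + 1)), (mix A (signal Ω s₀ C') i u + b i))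
      = 2 * κ i * δ i) →
    signal Ω s₀ C' = signal Ω s₀ C

end MixedTEM

end

noncomputable section

namespace MixedTEM

/-! Integrating from the start of a machine to one of its spikes gives an equation that is linear in
the joint vector `w` of coefficients and thresholds; its row `spikeRow` depends on the spike time.
The signal is determined once `J * K` such rows have independent coefficient parts. Independence at
almost all times is not enough, since the spike times depend on `w`.

The bridge is `volume_solutions_eq_zero`. By Cramer's rule, n independent equations parametrize `w`
by n times and the remaining free coordinates, so a null set of times yields only a null set of `w`.
Hence, for generic `w`, spikes with independent full rows avoid any prescribed null set of times,
such as the one where the coefficient parts are dependent (`ae_linearIndependent_rankOne`).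

That the full rows are independent is `IsGeneric.linearIndependent`. Otherwise some minimal
dependent family of m + 1 rows spans a space U of dimension m. Any m of them are independent, and
the last one is a coincidence, which `volume_coincidence_eq_zero` excludes unless any two of the
time derivatives are dependent modulo U. The span of the derivatives thus exceeds its intersection
with U by at most one dimension. But derivatives have no threshold entries and rows do, so this
intersection has codimension at least 1 in U, and at least 2 if two machines occur. This bounds the
number of independent derivatives by m, respectively m - 1. For one machine all m + 1 are
independent (a Cauchy matrix), for several at least m are (genericity): a contradiction.

Fubini turns almost all `w` into almost all coefficients for almost all thresholds, and the law of
the coefficients is absolutely continuous. -/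

/-! ### Isolated zeros, and linear systems with parameters in a null set. -/

/-- An injective derivative on a finite-dimensional space is bounded below, so each of these zeros
is isolated; a discrete subset of a separable metric space is countable. -/
theorem countable_of_zeros_of_injective_fderiv {E F : Type*} [NormedAddCommGroup E]
    [NormedSpace ℝ E] [FiniteDimensional ℝ E] [NormedAddCommGroup F] [NormedSpace ℝ F]
    {g : E → F} {S : Set E}
    (h : ∀ x ∈ S, g x = 0 ∧ ∃ g' : E →L[ℝ] F, HasFDerivAt g g' x ∧ ∀ y, g' y = 0 → y = 0) :
    S.Countable := by
  have : ProperSpace E := FiniteDimensional.proper ℝ E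
  have hd : IsDiscrete S := by
    rw [isDiscrete_iff_nhdsNE]
    intro x hx
    obtain ⟨-, g', hg', hinj⟩ := h x hx
    have hker : (g' : E →ₗ[ℝ] F).ker = ⊥ := by
      rw [LinearMap.ker_eq_bot']
      exact hinj
    obtain ⟨C, -, hC⟩ := LinearMap.exists_antilipschitzWith (g' : E →ₗ[ℝ] F) hker
    have := hg'.eventually_ne (c := 0) ⟨C, hC⟩
    rw [← disjoint_iff, Filter.disjoint_principal_right]
    filter_upwards [this] with z hz hzS using hz (h z hzS).1
  have : DiscreteTopology S := hd.to_subtype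
  have : Countable S := TopologicalSpace.separableSpace_iff_countable.1 inferInstance
  exact this

theorem differentiable_det {E n : Type*} [NormedAddCommGroup E] [NormedSpace ℝ E] [Fintype n]
    [DecidableEq n] {M : E → Matrix n n ℝ}
    (h : ∀ i j, Differentiable ℝ (fun x => M x i j)) : Differentiable ℝ (fun x => (M x).det) := by
  simp only [Matrix.det_apply']
  fun_prop

/-- The solutions of linear systems with independent rows and as many parameters as equations
form a null set, if the parameters are confined to a null set: the square case. -/
theorem volume_solutions_eq_zero_of_card_eq {ι : Type*} [Fintype ι] {n : ℕ}
    (hn : n = Fintype.card ι) {P : (Fin n → ℝ) → Fin n → ι → ℝ} {β : (Fin n → ℝ) → Fin n → ℝ}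
    (hP : ∀ j k, Differentiable ℝ (fun t => P t j k)) (hβ : ∀ j, Differentiable ℝ (fun t => β t j))
    {W : Set (Fin n → ℝ)} (hW : volume W = 0) :
    volume {w : ι → ℝ | ∃ t ∈ W, LinearIndependent ℝ (P t) ∧ ∀ j, ∑ k, P t j k * w k = β t j}
      = 0 := by
  classical
  let e : Fin n ≃ ι := (finCongr hn).trans (Fintype.equivFin ι).symm
  let M : (Fin n → ℝ) → Matrix (Fin n) (Fin n) ℝ := fun t => Matrix.of fun j k => P t j (e k)
  -- Cramer's rule: where the determinant is nonzero, the solution is a differentiable function of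
  -- equally many parameters, and such maps send null sets to null sets.
  let Ψ : (Fin n → ℝ) → (Fin n → ℝ) := fun t k =>
    (M t).det⁻¹ * ((M t).updateCol k (β t)).det
  let W' : Set (Fin n → ℝ) := W ∩ {t | (M t).det ≠ 0}
  have hM : ∀ j k, Differentiable ℝ (fun t => M t j k) := fun j k => hP j (e k)
  have hdiff : DifferentiableOn ℝ Ψ W' := by
    rw [differentiableOn_pi]
    intro k
    apply DifferentiableOn.mul
    · exact (differentiable_det hM).differentiableOn.inv fun t ht => ht.2
    · apply (differentiable_det _).differentiableOn
      intro i j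
      by_cases hjk : j = k
      · subst hjk; simpa using hβ i
      · simpa [Matrix.updateCol_ne hjk] using hM i j
  have h0 : volume (Ψ '' W') = 0 :=
    addHaar_image_eq_zero_of_differentiableOn_of_addHaar_eq_zero volume hdiff
      (measure_mono_null Set.inter_subset_left hW)
  have hmp := volume_measurePreserving_piCongrLeft (fun _ : ι => ℝ) e
  rw [← hmp.measure_preimage_equiv]
  refine measure_mono_null ?_ h0
  intro v hv
  obtain ⟨t, ht, hli, hw⟩ := hv
  have hrow : LinearIndependent ℝ (M t).row := by
    have : (M t).row = (LinearEquiv.funCongrLeft ℝ ℝ e) ∘ P t := by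
      ext j k; rfl
    rw [this]
    exact hli.map' _ (LinearEquiv.ker _)
  have hdet : (M t).det ≠ 0 := by
    rw [Matrix.linearIndependent_rows_iff_isUnit, Matrix.isUnit_iff_isUnit_det] at hrow
    exact hrow.ne_zero
  refine ⟨t, ⟨ht, hdet⟩, ?_⟩
  have hsol : (M t).mulVec v = β t := by
    ext j
    rw [← hw j, Matrix.mulVec, dotProduct, ← e.sum_comp]
    refine Finset.sum_congr rfl fun k _ => ?_
    congr 1
    exact (MeasurableEquiv.piCongrLeft_apply_apply (β := fun _ => ℝ) e v k).symm
  have hcr : (M t).cramer (β t) = (M t).det • v := by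
    rw [← hsol, Matrix.cramer_eq_adjugate_mulVec, Matrix.mulVec_mulVec, Matrix.adjugate_mul,
      Matrix.smul_mulVec, Matrix.one_mulVec]
  ext k
  have := congrFun hcr k
  rw [Matrix.cramer_apply] at this
  simp only [Ψ, this, Pi.smul_apply, smul_eq_mul]
  field_simp

theorem volume_preimage_init_eq_zero {n : ℕ} {W : Set (Fin n → ℝ)} (hW : volume W = 0) :
    volume {t : Fin (n + 1) → ℝ | Fin.init t ∈ W} = 0 := by
  have hmp := volume_preserving_piFinSuccAbove (fun _ : Fin (n + 1) => ℝ) (Fin.last n)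
  have : {t : Fin (n + 1) → ℝ | Fin.init t ∈ W} =
      (MeasurableEquiv.piFinSuccAbove (fun _ : Fin (n + 1) => ℝ) (Fin.last n)) ⁻¹'
        (Set.univ ×ˢ W) := by
    ext t
    have : Fin.init t = fun j => t ((Fin.last n).succAbove j) := by
      ext j; simp [Fin.init]
    simp [MeasurableEquiv.piFinSuccAbove, this]
  rw [this, hmp.measure_preimage_equiv, Measure.volume_eq_prod, Measure.prod_prod, hW, mul_zero]

/-- The solutions of linear systems with independent rows and as many parameters as equations
form a null set, if the parameters are confined to a null set. -/
theorem volume_solutions_eq_zero {ι : Type*} [Fintype ι] {n : ℕ}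
    {P : (Fin n → ℝ) → Fin n → ι → ℝ} {β : (Fin n → ℝ) → Fin n → ℝ}
    (hP : ∀ j k, Differentiable ℝ (fun t => P t j k)) (hβ : ∀ j, Differentiable ℝ (fun t => β t j))
    {W : Set (Fin n → ℝ)} (hW : volume W = 0) :
    volume {w : ι → ℝ | ∃ t ∈ W, LinearIndependent ℝ (P t) ∧ ∀ j, ∑ k, P t j k * w k = β t j}
      = 0 := by
  classical
  induction hd : Fintype.card ι - n generalizing n with
  | zero =>
    rcases (Nat.sub_eq_zero_iff_le.1 hd).eq_or_lt with h | h
    · exact volume_solutions_eq_zero_of_card_eq h.symm hP hβ hW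
    · convert measure_empty (μ := (volume : Measure (ι → ℝ)))
      ext w
      simp only [Set.mem_ofPred_eq, Set.mem_empty_iff_false, iff_false]
      rintro ⟨t, -, hli, -⟩
      have := hli.fintype_card_le_finrank
      simp at this
      omega
  | succ d ih =>
    -- Descend on the number of missing equations: add the equation `w i = u` with a new parameter
    -- `u`. Some coordinate vector lies outside the row span, so independence survives for a
    -- suitable `i`.
    let P' : ι → (Fin (n + 1) → ℝ) → Fin (n + 1) → ι → ℝ := fun i t =>
      Fin.snoc (P (Fin.init t)) (Pi.single i 1)
    let β' : (Fin (n + 1) → ℝ) → Fin (n + 1) → ℝ := fun t =>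
      Fin.snoc (β (Fin.init t)) (t (Fin.last n))
    have hinit : Differentiable ℝ (fun t : Fin (n + 1) → ℝ => (Fin.init t : Fin n → ℝ)) := by
      unfold Fin.init; fun_prop
    have key := fun i => ih (P := P' i) (β := β')
      (fun j k => by
        refine Fin.lastCases ?_ (fun j => ?_) j
        · simp [P']
        · simp only [P', Fin.snoc_castSucc]; exact (hP j k).comp hinit)
      (fun j => by
        refine Fin.lastCases ?_ (fun j => ?_) j
        · simp only [β', Fin.snoc_last]; fun_prop
        · simp only [β', Fin.snoc_castSucc]; exact (hβ j).comp hinit)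
      (volume_preimage_init_eq_zero hW) (by omega)
    refine measure_mono_null ?_ (measure_iUnion_null key)
    rintro w ⟨t, ht, hli, hw⟩
    obtain ⟨i, hi⟩ : ∃ i : ι, (Pi.single i 1 : ι → ℝ) ∉ Submodule.span ℝ (Set.range (P t)) := by
      by_contra! hcon
      have htop : Submodule.span ℝ (Set.range (P t)) = ⊤ := by
        rw [eq_top_iff, ← (Pi.basisFun ℝ ι).span_eq, Submodule.span_le]
        rintro _ ⟨i, rfl⟩
        simpa using hcon i
      have h1 := finrank_span_eq_card hli
      rw [htop, finrank_top] at h1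
      simp at h1
      omega
    refine Set.mem_iUnion.2 ⟨i, Fin.snoc t (w i), ?_, ?_, ?_⟩
    · simpa using ht
    · simp only [P', Fin.init_snoc]
      exact hli.finSnoc hi
    · intro j
      refine Fin.lastCases ?_ (fun j => ?_) j
      · simp [P', β', Pi.single_apply]
      · simpa [P', β'] using hw j

/-! ### Coincidences of curves. -/

/-- Projections of Borel sets need not be Borel; continuous images of σ-compact sets are σ-compact,
which makes the coincidence set measurable. -/
theorem isSigmaCompact_of_isLocallyClosed {X : Type*} [TopologicalSpace X] [LocallyCompactSpace X]
    [SecondCountableTopology X] {s : Set X} (hs : IsLocallyClosed s) : IsSigmaCompact s := by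
  rw [isSigmaCompact_iff_sigmaCompactSpace]
  have := hs.locallyCompactSpace
  infer_instance

theorem measurableSet_of_isSigmaCompact {X : Type*} [TopologicalSpace X] [T2Space X]
    [MeasurableSpace X] [BorelSpace X] {s : Set X} (hs : IsSigmaCompact s) : MeasurableSet s := by
  obtain ⟨K, hK, rfl⟩ := hs
  exact MeasurableSet.iUnion fun n => (hK n).isClosed.measurableSet

/-- A set of vectors of parameters `s : Fin (r + 1) → ℝ` is null if it is σ-compact and all its
sections in the direction of the `p`-th coordinate are countable. -/
theorem volume_eq_zero_of_countable_sections {r : ℕ} (p : Fin (r + 1))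
    {B : Set (Fin (r + 1) → ℝ)} (hB : MeasurableSet B)
    (h : ∀ s : Fin r → ℝ, {u : ℝ | p.insertNth u s ∈ B}.Countable) : volume B = 0 := by
  have hmp := (volume_preserving_piFinSuccAbove (fun _ : Fin (r + 1) => ℝ) p).symm
  have hmeas := hmp.measurable hB
  rw [← hmp.measure_preimage_equiv, Measure.volume_eq_prod, Measure.prod_apply_symm hmeas]
  refine lintegral_eq_zero_of_ae_eq_zero (Filter.Eventually.of_forall fun s => ?_)
  exact (h s).measure_zero volume

/-- Two curves meet, up to a nonzero factor and modulo further curves, transversally only at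
the parameters from a null set. -/
theorem volume_coincidence_eq_zero {V : Type*} [NormedAddCommGroup V] [NormedSpace ℝ V]
    [FiniteDimensional ℝ V] {r : ℕ} (p : Fin (r + 1)) {R : Fin (r + 1) → ℝ → V} {ρ' σ σ' : ℝ → V}
    (hR : ∀ a, Continuous (R a)) (hρ : ∀ u, HasDerivAt (R p) (ρ' u) u) (hρ' : Continuous ρ')
    (hσ : ∀ v, HasDerivAt σ (σ' v) v) (hσ' : Continuous σ') :
    volume {s : Fin (r + 1) → ℝ | ∃ (v : ℝ) (m : Fin (r + 1) → ℝ), m p ≠ 0 ∧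
      LinearIndependent ℝ (Fin.snoc (Fin.snoc (fun a => R a (s a)) (ρ' (s p)) : Fin (r + 2) → V)
        (σ' v) : Fin (r + 3) → V) ∧
      σ v = ∑ a, m a • R a (s a)} = 0 := by
  have hσc : Continuous σ := continuous_iff_continuousAt.2 fun v => (hσ v).continuousAt
  let Z : Set ((Fin (r + 1) → ℝ) × ℝ × (Fin (r + 1) → ℝ)) := {x | (x.2.2 p ≠ 0 ∧
      LinearIndependent ℝ (Fin.snoc (Fin.snoc (fun a => R a (x.1 a)) (ρ' (x.1 p)) : Fin (r + 2) → V)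
        (σ' x.2.1) : Fin (r + 3) → V)) ∧ σ x.2.1 = ∑ a, x.2.2 a • R a (x.1 a)}
  have hZ : IsLocallyClosed Z := by
    apply IsLocallyClosed.inter
    · apply IsOpen.isLocallyClosed
      apply IsOpen.inter
      · exact isOpen_ne_fun (by fun_prop) (by fun_prop)
      · refine isOpen_setOfPred_linearIndependent.preimage ?_
        refine Continuous.finSnoc (Continuous.finSnoc ?_ ?_) ?_ <;> fun_prop
    · apply IsClosed.isLocallyClosed
      exact isClosed_eq (by fun_prop) (by fun_prop)
  have hB := measurableSet_of_isSigmaCompact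
    ((isSigmaCompact_of_isLocallyClosed hZ).image continuous_fst)
  have hset : {s : Fin (r + 1) → ℝ | ∃ (v : ℝ) (m : Fin (r + 1) → ℝ), m p ≠ 0 ∧
      LinearIndependent ℝ (Fin.snoc (Fin.snoc (fun a => R a (s a)) (ρ' (s p)) : Fin (r + 2) → V)
        (σ' v) : Fin (r + 3) → V) ∧
      σ v = ∑ a, m a • R a (s a)} = Prod.fst '' Z := by
    ext s
    constructor
    · rintro ⟨v, m, h1, h2, h3⟩
      exact ⟨(s, v, m), ⟨⟨h1, h2⟩, h3⟩, rfl⟩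
    · rintro ⟨⟨s, v, m⟩, ⟨⟨h1, h2⟩, h3⟩, rfl⟩
      exact ⟨v, m, h1, h2, h3⟩
  rw [hset]
  refine volume_eq_zero_of_countable_sections p hB fun s => ?_
  -- With all times but the `p`-th fixed, the unknowns are that time, `v` and `m`.
  let S : Set (ℝ × ℝ × (Fin (r + 1) → ℝ)) := {x | (p.insertNth x.1 s, x.2) ∈ Z}
  have hS : S.Countable := by
    apply countable_of_zeros_of_injective_fderiv
      (g := fun x => x.2.2 p • R p x.1 + ∑ b, x.2.2 (p.succAbove b) • R (p.succAbove b) (s b)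
        - σ x.2.1)
    rintro ⟨u, v, m⟩ ⟨⟨hm, hli⟩, heq⟩
    simp only at hm heq
    simp only [Fin.insertNth_apply_same] at hli
    refine ⟨?_, ?_⟩
    · rw [heq, Fin.sum_univ_succAbove _ p]
      simp
    · let pr : Fin (r + 1) → (ℝ × ℝ × (Fin (r + 1) → ℝ)) →L[ℝ] ℝ := fun b =>
        (ContinuousLinearMap.proj (R := ℝ) (φ := fun _ : Fin (r + 1) => ℝ) b).comp
          ((ContinuousLinearMap.snd ℝ ℝ (Fin (r + 1) → ℝ)).comp
            (ContinuousLinearMap.snd ℝ ℝ (ℝ × (Fin (r + 1) → ℝ))))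
      have hproj : ∀ b : Fin (r + 1), HasFDerivAt
          (fun x : ℝ × ℝ × (Fin (r + 1) → ℝ) => x.2.2 b) (pr b) (u, v, m) :=
        fun b => (pr b).hasFDerivAt
      have hRp : HasFDerivAt (fun x : ℝ × ℝ × (Fin (r + 1) → ℝ) => R p x.1) _ (u, v, m) :=
        HasFDerivAt.comp (u, v, m) (hρ u).hasFDerivAt hasFDerivAt_fst
      have hσv : HasFDerivAt (fun x : ℝ × ℝ × (Fin (r + 1) → ℝ) => σ x.2.1) _ (u, v, m) :=
        HasFDerivAt.comp (u, v, m) (hσ v).hasFDerivAt (HasFDerivAt.fst hasFDerivAt_snd)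
      refine ⟨_, (((hproj p).smul hRp).add (HasFDerivAt.fun_sum fun b _ =>
        (hproj (p.succAbove b)).smul_const (R (p.succAbove b) (s b)))).sub hσv, ?_⟩
      rintro ⟨du, dv, dm⟩ h0
      simp [pr] at h0
      rw [Fintype.linearIndependent_iff] at hli
      -- The derivative combines the independent vectors with coefficients `dm`, `m p * du` and
      -- `-dv`; as `m p ≠ 0`, its kernel is trivial.
      have hc := hli (Fin.snoc (Fin.snoc dm (m p * du) : Fin (r + 2) → ℝ) (-dv)) (by
        rw [Fin.sum_univ_castSucc, Fin.sum_univ_castSucc, Fin.sum_univ_succAbove _ p]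
        simp only [Fin.snoc_castSucc, Fin.snoc_last, Fin.insertNth_apply_same,
          Fin.insertNth_apply_succAbove]
        rw [← h0]
        module)
      have e1 : ∀ a, dm a = 0 := fun a => by simpa using hc a.castSucc.castSucc
      have e2 : m p * du = 0 := by simpa using hc (Fin.last _).castSucc
      have e3 : -dv = 0 := by simpa using hc (Fin.last _)
      have e2' : du = 0 := by simpa [hm] using e2
      have e3' : dv = 0 := by simpa using e3
      have e1' : dm = 0 := funext e1
      simp [e1', e2', e3']
  refine (hS.image Prod.fst).mono ?_
  rintro u ⟨⟨s', x⟩, hx, hs'⟩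
  simp only at hs'
  subst hs'
  exact ⟨(u, x), hx, rfl⟩

/-! ### Generic nonvanishing along curves. -/

/-- Freezing all arguments but the first where the form is nonzero leaves a nonzero functional. For
almost every first time it does not vanish on the curve, so the curried form is nonzero; induction
and Fubini finish. -/
theorem ae_multilinear_ne_zero {E : Type*} [NormedAddCommGroup E] [NormedSpace ℝ E]
    {n : ℕ} (Φ : MultilinearMap ℝ (fun _ : Fin n => E) ℝ) (hΦc : Continuous Φ) (hΦ : Φ ≠ 0)
    {g : Fin n → ℝ → E} (hgc : ∀ j, Continuous (g j))
    (hg : ∀ j, ∀ ψ : E →ₗ[ℝ] ℝ, ψ ≠ 0 → ∀ᵐ t, ψ (g j t) ≠ 0) :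
    ∀ᵐ t : Fin n → ℝ, Φ (fun j => g j (t j)) ≠ 0 := by
  induction n with
  | zero =>
    refine Filter.Eventually.of_forall fun t h => hΦ ?_
    ext u
    rw [Subsingleton.elim u (fun j => g j (t j)), h]
    rfl
  | succ n ih =>
    have hmp := (volume_preserving_piFinSuccAbove (fun _ : Fin (n + 1) => ℝ) 0).symm
    have hmeas : MeasurableSet {t : Fin (n + 1) → ℝ | Φ (fun j => g j (t j)) = 0} :=
      (isClosed_eq (hΦc.comp (by fun_prop))
        continuous_const).measurableSet
    have hmeas' := hmp.measurable hmeas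
    rw [ae_iff]
    simp only [ne_eq, not_not]
    rw [← hmp.measure_preimage_equiv, Measure.volume_eq_prod, Measure.measure_prod_null hmeas']
    obtain ⟨u, hu⟩ : ∃ u, Φ u ≠ 0 := by
      by_contra! hcon
      exact hΦ (MultilinearMap.ext hcon)
    let ψ : E →ₗ[ℝ] ℝ :=
      { toFun := fun x => Φ.curryLeft x (fun j => u j.succ)
        map_add' := fun x y => by simp
        map_smul' := fun c x => by simp }
    have hψ : ψ ≠ 0 := by
      intro h
      apply hu
      have := LinearMap.congr_fun h (u 0)
      rw [← Fin.cons_self_tail u]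
      exact this
    filter_upwards [hg 0 ψ hψ] with t₀ ht₀
    have hne : Φ.curryLeft (g 0 t₀) ≠ 0 := by
      intro h
      apply ht₀
      change Φ.curryLeft (g 0 t₀) _ = 0
      rw [h]; rfl
    have hcont : Continuous (Φ.curryLeft (g 0 t₀)) :=
      hΦc.comp (Continuous.finCons continuous_const continuous_id)
    have := ih _ hcont hne (g := fun j => g j.succ) (fun j => hgc _) (fun j => hg _)
    rw [ae_iff] at this
    simp only [ne_eq, not_not] at this
    rw [Pi.zero_apply, ← this]
    congr 1
    ext t
    simp only [Set.mem_preimage, Set.mem_ofPred_eq, MultilinearMap.curryLeft_apply]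
    have : (fun j => g j ((MeasurableEquiv.piFinSuccAbove (fun _ : Fin (n + 1) => ℝ) 0).symm
        (t₀, t) j)) = Fin.cons (g 0 t₀) (fun j => g j.succ (t j)) := by
      ext j
      refine Fin.cases ?_ (fun j => ?_) j
      · simp [MeasurableEquiv.piFinSuccAbove]
      · simp [MeasurableEquiv.piFinSuccAbove]
    rw [this]

/-- After composing with a left inverse of the independent family, independence follows from the
nonvanishing of a determinant, a multilinear form with value 1 at `u`. -/
theorem ae_linearIndependent_of_exists {E V : Type*} [NormedAddCommGroup E] [NormedSpace ℝ E]
    [FiniteDimensional ℝ E] [AddCommGroup V] [Module ℝ V] {n : ℕ} (T : Fin n → E →ₗ[ℝ] V)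
    {u : Fin n → E} (hu : LinearIndependent ℝ (fun j => T j (u j)))
    {g : Fin n → ℝ → E} (hgc : ∀ j, Continuous (g j))
    (hg : ∀ j, ∀ ψ : E →ₗ[ℝ] ℝ, ψ ≠ 0 → ∀ᵐ t, ψ (g j t) ≠ 0) :
    ∀ᵐ t : Fin n → ℝ, LinearIndependent ℝ (fun j => T j (g j (t j))) := by
  classical
  obtain ⟨L, hL⟩ := (Fintype.linearCombination ℝ (fun j => T j (u j))).exists_leftInverse_of_injective
    (by
      rw [LinearMap.ker_eq_bot']
      exact fun c hc => funext (Fintype.linearIndependent_iff.1 hu c hc))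
  have hLu : ∀ j, L (T j (u j)) = Pi.single j 1 := fun j => by
    have := LinearMap.congr_fun hL (Pi.single j 1)
    simpa [Fintype.linearCombination_apply_single] using this
  let Φ : MultilinearMap ℝ (fun _ : Fin n => E) ℝ :=
    (Matrix.detRowAlternating (n := Fin n) (R := ℝ)).toMultilinearMap.compLinearMap
      (fun j => L ∘ₗ T j)
  have hΦ : ∀ x, Φ x = Matrix.det (Matrix.of fun j => L (T j (x j))) := fun x => rfl
  have hcont : Continuous Φ := by
    refine Continuous.matrix_det (continuous_matrix fun i j => ?_)
    have hc : Continuous (fun y : E => L (T i y) j) :=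
      ((LinearMap.proj j ∘ₗ L ∘ₗ T i) : E →ₗ[ℝ] ℝ).continuous_of_finiteDimensional
    exact hc.comp (continuous_apply i)
  have hne : Φ ≠ 0 := by
    intro h
    have h1 : Φ u = 1 := by
      rw [hΦ]
      simp only [hLu]
      convert Matrix.det_one (n := Fin n) (R := ℝ)
      ext i j
      simp [Matrix.one_apply, Pi.single_apply, eq_comm]
    rw [h] at h1
    simp at h1
  filter_upwards [ae_multilinear_ne_zero Φ hcont hne hgc hg] with t ht
  rw [hΦ] at ht
  have h2 := Matrix.linearIndependent_rows_iff_isUnit.2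
    ((Matrix.isUnit_iff_isUnit_det _).2 (isUnit_iff_ne_zero.2 ht))
  exact LinearIndependent.of_comp L h2

/-! ### Independence of rank one matrices built from rows of `A`. -/

/-- A number `q ≤ J K` of slots, each coloured by `i`, with at most `K` slots of each colour, can
be distributed among `K` boxes, such that each box has at most `J` slots, of different colours. -/
theorem exists_distribution {J K q : ℕ} {α : Type*} [LinearOrder α] (i : Fin q → α) (hq : q ≤ J * K)
    (hi : ∀ a, (Finset.univ.filter fun j => i j = a).card ≤ K) :
    ∃ k : Fin q → Fin K, (∀ j j', k j = k j' → i j = i j' → j = j') ∧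
      ∀ b, (Finset.univ.filter fun j => k j = b).card ≤ J := by
  rcases Nat.eq_zero_or_pos K with rfl | hK
  · have : q = 0 := by simpa using hq
    subst this
    exact ⟨fun j => j.elim0, fun j => j.elim0, fun b => b.elim0⟩
  have hmono := Tuple.monotone_sort i
  set π := Tuple.sort i with hπ
  -- Sort the slots by colour and deal them out cyclically. Two positions with the same residue are
  -- at least `K` apart; equal colours there would force `K + 1` slots of one colour.
  let k : Fin q → Fin K := fun j => ⟨(π.symm j : ℕ) % K, Nat.mod_lt _ hK⟩
  have key : ∀ m m' : Fin q, m < m' → (m : ℕ) % K = (m' : ℕ) % K → i (π m) ≠ i (π m') := by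
    intro m m' hlt hmod heq
    have hge : (m : ℕ) + K ≤ m' := by
      have h1 : (m : ℕ) < m' := hlt
      have h2 : (m : ℕ) ≡ m' [MOD K] := hmod
      have h3 := (Nat.modEq_iff_dvd' h1.le).1 h2
      have := Nat.le_of_dvd (by omega) h3
      omega
    have hcard := hi (i (π m))
    have hsub : (Finset.Icc m m').map π.toEmbedding ⊆
        Finset.univ.filter fun j => i j = i (π m) := by
      intro j hj
      simp only [Finset.mem_map, Finset.mem_Icc] at hj
      obtain ⟨x, ⟨hx1, hx2⟩, rfl⟩ := hj
      simp only [Finset.mem_filter, Finset.mem_univ, true_and]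
      exact le_antisymm ((hmono hx2).trans_eq heq.symm) (hmono hx1)
    have h4 := Finset.card_le_card hsub
    rw [Finset.card_map, Fin.card_Icc] at h4
    omega
  refine ⟨k, ?_, ?_⟩
  · intro j j' hk hij
    have hmod : (π.symm j : ℕ) % K = (π.symm j' : ℕ) % K := congrArg Fin.val hk
    rcases lt_trichotomy (π.symm j) (π.symm j') with h | h | h
    · exact absurd (by simpa using hij) (key _ _ h hmod)
    · exact π.symm.injective h
    · exact absurd (by simpa using hij.symm) (key _ _ h hmod.symm)
  · intro b
    have : (Finset.univ.filter fun j => k j = b).card ≤ (Finset.range J).card := by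
      refine Finset.card_le_card_of_injOn (fun j => (π.symm j : ℕ) / K) ?_ ?_
      · intro j _
        simp only [Finset.coe_range, Set.mem_Iio]
        exact Nat.div_lt_of_lt_mul (by have := (π.symm j).2; rw [mul_comm]; omega)
      · intro j hj j' hj' hdiv
        simp only [Finset.coe_filter, Finset.mem_univ, true_and, Set.mem_ofPred_eq] at hj hj'
        have h1 : (π.symm j : ℕ) % K = b := congrArg Fin.val hj
        have h2 : (π.symm j' : ℕ) % K = b := congrArg Fin.val hj'
        apply π.symm.injective
        apply Fin.ext
        rw [← Nat.div_add_mod (π.symm j : ℕ) K, ← Nat.div_add_mod (π.symm j' : ℕ) K, h1, h2]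
        simp only at hdiv
        rw [hdiv]
    simpa using this

/-- The rank one matrix with columns proportional to the `i`-th row of `A`. -/
def rankOne {I J K : ℕ} (A : Matrix (Fin I) (Fin J) ℝ) (i : Fin I) :
    (Fin K → ℝ) →ₗ[ℝ] (Fin J × Fin K → ℝ) where
  toFun x := fun p => A i p.1 * x p.2
  map_add' x y := by ext p; simp [mul_add]
  map_smul' c x := by ext p; simp [mul_left_comm]

theorem linearIndependent_rows_of_card_le {I J : ℕ} {A : Matrix (Fin I) (Fin J) ℝ} (hIJ : J ≤ I)
    (hA : ∀ r : Fin J ↪ Fin I, LinearIndependent ℝ (fun j => A.row (r j)))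
    {s : Finset (Fin I)} (hs : s.card ≤ J) : LinearIndependent ℝ (fun i : s => A.row i) := by
  obtain ⟨s', hss', hs'⟩ := Finset.exists_superset_card_eq hs (by simpa using hIJ)
  let e : Fin J ≃ s' := (finCongr hs'.symm).trans s'.equivFin.symm
  have h1 := hA (e.toEmbedding.trans (Function.Embedding.subtype _))
  have h2 := h1.comp (fun i : s => e.symm ⟨i, hss' i.2⟩) (by
    intro i i' h
    have := congrArg Subtype.val (e.symm.injective h)
    exact Subtype.ext this)
  convert h2 using 2 with i
  simp

/-- Taking coordinate vectors for `u` puts each rank one matrix into a single column. A relation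
then splits into one relation per column, among at most `J` distinct rows of `A`. -/
theorem exists_linearIndependent_rankOne {I J K q : ℕ} {A : Matrix (Fin I) (Fin J) ℝ}
    (hIJ : J ≤ I) (hA : ∀ r : Fin J ↪ Fin I, LinearIndependent ℝ (fun j => A.row (r j)))
    (i : Fin q → Fin I) (hq : q ≤ J * K)
    (hi : ∀ a, (Finset.univ.filter fun j => i j = a).card ≤ K) :
    ∃ u : Fin q → Fin K → ℝ, LinearIndependent ℝ (fun j => rankOne A (i j) (u j)) := by
  obtain ⟨k, hk1, hk2⟩ := exists_distribution i hq hi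
  refine ⟨fun j => Pi.single (k j) 1, ?_⟩
  rw [Fintype.linearIndependent_iff]
  intro c hc j₀
  let F : Finset (Fin q) := Finset.univ.filter fun j => k j = k j₀
  have hinj : Set.InjOn i F := by
    intro j hj j' hj' h
    simp only [F, Finset.coe_filter, Finset.mem_univ, true_and, Set.mem_ofPred_eq] at hj hj'
    exact hk1 j j' (hj.trans hj'.symm) h
  have hli := linearIndependent_rows_of_card_le hIJ hA (s := F.image i)
    (Finset.card_image_le.trans (hk2 _))
  have hli' : LinearIndependent ℝ (fun j : F => A.row (i j)) :=
    hli.comp (fun j : F => ⟨i j, Finset.mem_image_of_mem _ j.2⟩) (by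
      intro j j' h
      exact Subtype.ext (hinj j.2 j'.2 (by simpa using h)))
  rw [Fintype.linearIndependent_iff] at hli'
  refine hli' (fun j => c j) ?_ ⟨j₀, by simp [F]⟩
  ext a
  have h1 := congrFun hc (a, k j₀)
  simp only [Finset.sum_apply, Pi.smul_apply, rankOne, LinearMap.coe_mk, AddHom.coe_mk,
    smul_eq_mul, Pi.zero_apply, Pi.single_apply] at h1 ⊢
  rw [Finset.sum_coe_sort F (fun j => c j * A.row (i j) a), Finset.sum_filter]
  refine Eq.trans ?_ h1
  refine Finset.sum_congr rfl fun j _ => ?_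
  by_cases h : k j = k j₀
  · simp [h, Matrix.row]
  · simp [h, Ne.symm h]

/-- Generic rank one matrices of the form `a ⊗ g(t)` are linearly independent, as far as the
dimensions permit it. -/
theorem ae_linearIndependent_rankOne {I J K q : ℕ} {A : Matrix (Fin I) (Fin J) ℝ}
    (hIJ : J ≤ I) (hA : ∀ r : Fin J ↪ Fin I, LinearIndependent ℝ (fun j => A.row (r j)))
    (i : Fin q → Fin I) (hq : q ≤ J * K)
    (hi : ∀ a, (Finset.univ.filter fun j => i j = a).card ≤ K)
    {g : Fin q → ℝ → Fin K → ℝ} (hgc : ∀ j, Continuous (g j))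
    (hg : ∀ j, ∀ ψ : (Fin K → ℝ) →ₗ[ℝ] ℝ, ψ ≠ 0 → ∀ᵐ t, ψ (g j t) ≠ 0) :
    ∀ᵐ t : Fin q → ℝ, LinearIndependent ℝ (fun j => rankOne A (i j) (g j (t j))) := by
  obtain ⟨u, hu⟩ := exists_linearIndependent_rankOne hIJ hA i hq hi
  exact ae_linearIndependent_of_exists (fun j => rankOne A (i j)) hu hgc hg

/-! ### Shifted kernels and Cauchy matrices. -/

/-- Clearing denominators in a relation gives a polynomial of degree less than `K` with the `K`
zeros `y k`. It is therefore zero, and evaluating it at `x j₀` isolates the coefficient `c j₀`. -/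
theorem linearIndependent_cauchy {ι : Type*} [Fintype ι] {K : ℕ} (hK : Fintype.card ι ≤ K)
    {x : ι → ℝ} (hx : Function.Injective x) {y : Fin K → ℝ} (hy : Function.Injective y)
    (hxy : ∀ j k, x j ≠ y k) :
    LinearIndependent ℝ (fun j : ι => fun k : Fin K => (x j - y k)⁻¹) := by
  classical
  rw [Fintype.linearIndependent_iff]
  intro c hc j₀
  have hpos : 0 < Fintype.card ι := Fintype.card_pos_iff.2 ⟨j₀⟩
  let p : Polynomial ℝ := ∑ j, Polynomial.C (c j) *
    ∏ j' ∈ Finset.univ.erase j, (Polynomial.C (x j') - Polynomial.X)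
  have hdeg : p.natDegree < Fintype.card (Fin K) := by
    have : p.natDegree ≤ Fintype.card ι - 1 := by
      refine Polynomial.natDegree_sum_le_of_forall_le _ _ fun j _ => ?_
      refine (Polynomial.natDegree_C_mul_le _ _).trans ?_
      refine (Polynomial.natDegree_prod_le _ _).trans ?_
      refine (Finset.sum_le_card_nsmul _ _ 1 fun j' _ => ?_).trans ?_
      · refine (Polynomial.natDegree_sub_le _ _).trans (by simp)
      · simp [Finset.card_erase_of_mem, Finset.card_univ]
    rw [Fintype.card_fin]
    omega
  have hp : p = 0 := by
    refine Polynomial.eq_zero_of_natDegree_lt_card_of_eval_eq_zero p hy (fun k => ?_) hdeg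
    have h1 := congrFun hc k
    simp only [Finset.sum_apply, Pi.smul_apply, smul_eq_mul, Pi.zero_apply] at h1
    have h2 : p.eval (y k) = (∏ j, (x j - y k)) * ∑ j, c j * (x j - y k)⁻¹ := by
      simp only [p, Polynomial.eval_finsetSum, Polynomial.eval_mul, Polynomial.eval_C,
        Polynomial.eval_prod, Polynomial.eval_sub, Polynomial.eval_X, Finset.mul_sum]
      refine Finset.sum_congr rfl fun j _ => ?_
      rw [← Finset.mul_prod_erase _ _ (Finset.mem_univ j)]
      have := sub_ne_zero.2 (hxy j k)
      field_simp
    rw [h2, h1, mul_zero]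
  have h3 : p.eval (x j₀) = c j₀ * ∏ j' ∈ Finset.univ.erase j₀, (x j' - x j₀) := by
    simp only [p, Polynomial.eval_finsetSum, Polynomial.eval_mul, Polynomial.eval_C,
      Polynomial.eval_prod, Polynomial.eval_sub, Polynomial.eval_X]
    rw [Finset.sum_eq_single j₀]
    · intro j _ hj
      rw [Finset.prod_eq_zero (i := j₀) (by simp [Ne.symm hj]) (sub_self _), mul_zero]
    · simp
  rw [hp, Polynomial.eval_zero] at h3
  refine (mul_eq_zero.1 h3.symm).resolve_right ?_
  exact Finset.prod_ne_zero_iff.2 fun j' hj' =>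
    sub_ne_zero.2 fun h => (Finset.ne_of_mem_erase hj') (hx h)

/-- The sampling times `t_k` of the model. -/
def node (Ω s₀ : ℝ) (k : ℕ) : ℝ := ((k : ℝ) + 1) * Real.pi / Ω + s₀

/-- The vector of the shifted kernels at time `t`. -/
def sincVec (K : ℕ) (Ω s₀ t : ℝ) : Fin K → ℝ := fun k => sincΩ Ω (t - node Ω s₀ k)

/-- The vector of the primitives of the shifted kernels that vanish at `t₀`. -/
def sincPrim (K : ℕ) (Ω s₀ t₀ t : ℝ) : Fin K → ℝ :=
  fun k => ∫ u in t₀..t, sincΩ Ω (u - node Ω s₀ k)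

theorem continuous_sincΩ (Ω : ℝ) : Continuous (sincΩ Ω) := by
  unfold sincΩ
  exact continuous_const.mul (Real.continuous_sinc.comp (by fun_prop))

theorem continuous_sincVec (K : ℕ) (Ω s₀ : ℝ) : Continuous (sincVec K Ω s₀) := by
  refine continuous_pi fun k => ?_
  exact (continuous_sincΩ Ω).comp (by fun_prop)

theorem hasDerivAt_sincPrim (K : ℕ) (Ω s₀ t₀ t : ℝ) :
    HasDerivAt (sincPrim K Ω s₀ t₀) (sincVec K Ω s₀ t) t := by
  rw [hasDerivAt_pi]
  intro k
  exact (((continuous_sincΩ Ω).comp (by fun_prop : Continuous fun u : ℝ => u - node Ω s₀ k)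
    ).integral_hasStrictDerivAt t₀ t).hasDerivAt

theorem continuous_sincPrim (K : ℕ) (Ω s₀ t₀ : ℝ) : Continuous (sincPrim K Ω s₀ t₀) :=
  continuous_iff_continuousAt.2 fun t => (hasDerivAt_sincPrim K Ω s₀ t₀ t).continuousAt

/-- The zeros of `sin (Ω (t - s₀))`. -/
def lattice (Ω s₀ : ℝ) : Set ℝ := {t | Real.sin (Ω * (t - s₀)) = 0}

theorem countable_lattice {Ω : ℝ} (hΩ : 0 < Ω) (s₀ : ℝ) : (lattice Ω s₀).Countable := by
  refine (Set.countable_range (fun n : ℤ => (n : ℝ) * Real.pi / Ω + s₀)).mono ?_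
  intro t ht
  obtain ⟨n, hn⟩ := Real.sin_eq_zero_iff.1 ht
  refine ⟨n, ?_⟩
  simp only [hn]
  field_simp
  ring

theorem sin_mul_sub_node {Ω : ℝ} (hΩ : 0 < Ω) (s₀ t : ℝ) (k : ℕ) :
    Real.sin (Ω * (t - node Ω s₀ k)) = (-1) ^ (k + 1) * Real.sin (Ω * (t - s₀)) := by
  have : Ω * (t - node Ω s₀ k) = Ω * (t - s₀) - (k + 1 : ℕ) * Real.pi := by
    unfold node
    push_cast
    field_simp
    ring
  rw [this, Real.sin_sub_nat_mul_pi]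

theorem node_mem_lattice {Ω : ℝ} (hΩ : 0 < Ω) (s₀ : ℝ) (k : ℕ) : node Ω s₀ k ∈ lattice Ω s₀ := by
  have := sin_mul_sub_node hΩ s₀ (node Ω s₀ k) k
  rw [sub_self, mul_zero, Real.sin_zero] at this
  exact (mul_eq_zero.1 this.symm).resolve_left (by simp)

theorem node_injective {Ω : ℝ} (hΩ : 0 < Ω) (s₀ : ℝ) : Function.Injective (node Ω s₀) := by
  intro k k' h
  unfold node at h
  have hpi := Real.pi_pos
  field_simp at h
  have : ((k : ℝ) - k') * Real.pi = 0 := by linarith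
  have : (k : ℝ) = k' := sub_eq_zero.1 ((mul_eq_zero.1 this).resolve_right hpi.ne')
  exact_mod_cast this

/-- All shifted sines agree up to sign, so off the lattice the kernel vector is a Cauchy row up to a
factor depending on `t` and a sign depending on `k`. -/
theorem sincVec_apply_of_notMem {K : ℕ} {Ω : ℝ} (hΩ : 0 < Ω) {s₀ t : ℝ} (ht : t ∉ lattice Ω s₀)
    (k : Fin K) : sincVec K Ω s₀ t k =
      Real.sin (Ω * (t - s₀)) / Real.pi * ((t - node Ω s₀ k)⁻¹ * (-1) ^ ((k : ℕ) + 1)) := by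
  have hne : t - node Ω s₀ k ≠ 0 := by
    intro h
    exact ht (sub_eq_zero.1 h ▸ node_mem_lattice hΩ s₀ k)
  rw [sincVec, sincΩ, Real.sinc_of_ne_zero (mul_ne_zero hΩ.ne' hne), sin_mul_sub_node hΩ]
  have := Real.pi_pos
  field_simp

theorem linearIndependent_sincVec {ι : Type*} [Fintype ι] {K : ℕ} (hK : Fintype.card ι ≤ K)
    {Ω : ℝ} (hΩ : 0 < Ω) {s₀ : ℝ} {t : ι → ℝ} (ht : Function.Injective t)
    (htl : ∀ j, t j ∉ lattice Ω s₀) : LinearIndependent ℝ (fun j => sincVec K Ω s₀ (t j)) := by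
  have h := linearIndependent_cauchy hK ht (y := fun k : Fin K => node Ω s₀ k)
    (fun k k' h => Fin.ext (node_injective hΩ s₀ h))
    (fun j k h => htl j (h ▸ node_mem_lattice hΩ s₀ k))
  rw [Fintype.linearIndependent_iff] at h ⊢
  intro c hc j
  have hsin : Real.sin (Ω * (t j - s₀)) / Real.pi ≠ 0 :=
    div_ne_zero (htl j) Real.pi_pos.ne'
  refine (mul_eq_zero.1 (h (fun j => c j * (Real.sin (Ω * (t j - s₀)) / Real.pi)) ?_ j)
    ).resolve_right hsin
  ext k
  have h1 := congrFun hc k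
  simp only [Finset.sum_apply, Pi.smul_apply, smul_eq_mul, Pi.zero_apply] at h1 ⊢
  simp only [sincVec_apply_of_notMem hΩ (htl _)] at h1
  have h2 : (∑ j, c j * (Real.sin (Ω * (t j - s₀)) / Real.pi) * (t j - node Ω s₀ k)⁻¹) *
      (-1) ^ ((k : ℕ) + 1) = 0 := by
    rw [Finset.sum_mul, ← h1]
    exact Finset.sum_congr rfl fun j _ => by ring
  exact (mul_eq_zero.1 h2).resolve_right (by simp)

/-- Infinitely many zeros off the lattice would include `K` whose kernel vectors form a basis,
forcing `ψ = 0`. -/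
theorem countable_zeros_sincVec {K : ℕ} {Ω : ℝ} (hΩ : 0 < Ω) (s₀ : ℝ) {ψ : (Fin K → ℝ) →ₗ[ℝ] ℝ}
    (hψ : ψ ≠ 0) : {t | ψ (sincVec K Ω s₀ t) = 0}.Countable := by
  have hfin : ({t | ψ (sincVec K Ω s₀ t) = 0} \ lattice Ω s₀).Finite := by
    by_contra hinf
    have hinf : ({t | ψ (sincVec K Ω s₀ t) = 0} \ lattice Ω s₀).Infinite := hinf
    let e := hinf.natEmbedding
    let t : Fin K → ℝ := fun j => e j
    have hli := linearIndependent_sincVec (ι := Fin K) (K := K) (by simp) hΩ (t := t)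
      (fun j j' h => Fin.ext (e.injective (Subtype.ext h))) (fun j => (e j).2.2)
    have hspan : Submodule.span ℝ (Set.range fun j => sincVec K Ω s₀ (t j)) = ⊤ :=
      hli.span_eq_top_of_card_eq_finrank' (by simp)
    apply hψ
    refine LinearMap.ext_on_range hspan fun j => ?_
    exact (e j).2.1
  refine (hfin.countable.union (countable_lattice hΩ s₀)).mono ?_
  intro t ht
  by_cases h : t ∈ lattice Ω s₀
  · exact Or.inr h
  · exact Or.inl ⟨ht, h⟩

/-- A zero is either a zero of the derivative `ψ (sincVec K Ω s₀ t)` or simple, hence isolated. -/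
theorem countable_zeros_sincPrim {K : ℕ} {Ω : ℝ} (hΩ : 0 < Ω) (s₀ t₀ : ℝ)
    {ψ : (Fin K → ℝ) →ₗ[ℝ] ℝ} (hψ : ψ ≠ 0) :
    {t | ψ (sincPrim K Ω s₀ t₀ t) = 0}.Countable := by
  have h1 : ({t | ψ (sincPrim K Ω s₀ t₀ t) = 0} \ {t | ψ (sincVec K Ω s₀ t) = 0}).Countable := by
    apply countable_of_zeros_of_injective_fderiv (g := fun t => ψ (sincPrim K Ω s₀ t₀ t))
    rintro t ⟨ht, ht'⟩
    have hd : HasDerivAt (fun t => ψ (sincPrim K Ω s₀ t₀ t)) (ψ (sincVec K Ω s₀ t)) t :=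
      (ψ.toContinuousLinearMap.hasFDerivAt (x := sincPrim K Ω s₀ t₀ t)).comp_hasDerivAt t
        (hasDerivAt_sincPrim K Ω s₀ t₀ t)
    refine ⟨ht, _, hd.hasFDerivAt, fun y hy => ?_⟩
    simp only [ContinuousLinearMap.toSpanSingleton_apply, smul_eq_mul, mul_eq_zero] at hy
    exact hy.resolve_right ht'
  refine (h1.union (countable_zeros_sincVec hΩ s₀ hψ)).mono ?_
  intro t ht
  by_cases h : ψ (sincVec K Ω s₀ t) = 0
  · exact Or.inr h
  · exact Or.inl ⟨ht, h⟩

/-! ### Minimal dependent families and dimension counts. -/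

/-- A dependent finite family has a minimal dependent subfamily. -/
theorem exists_circuit {V : Type*} [AddCommGroup V] [Module ℝ V] {q : ℕ} {v : Fin q → V}
    (hv : ¬ LinearIndependent ℝ v) :
    ∃ (m : ℕ) (e : Fin (m + 1) ↪ Fin q) (c : Fin (m + 1) → ℝ), (∀ j, c j ≠ 0) ∧
      ∑ j, c j • v (e j) = 0 ∧
      ∀ p : Fin (m + 1), LinearIndependent ℝ fun j => v (e (p.succAbove j)) := by
  classical
  have hex : ∃ n, ∃ e : Fin n ↪ Fin q, ¬ LinearIndependent ℝ fun j => v (e j) :=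
    ⟨q, Function.Embedding.refl _, hv⟩
  obtain ⟨e, he⟩ := Nat.find_spec hex
  have hmin : ∀ n, n < Nat.find hex → ∀ e : Fin n ↪ Fin q, LinearIndependent ℝ fun j => v (e j) :=
    fun n hn e => by
      by_contra h
      exact Nat.find_min hex hn ⟨e, h⟩
  obtain ⟨m, hm⟩ : ∃ m, Nat.find hex = m + 1 := by
    refine Nat.exists_eq_succ_of_ne_zero fun h0 => he ?_
    have : IsEmpty (Fin (Nat.find hex)) := by rw [h0]; infer_instance
    exact linearIndependent_empty_type
  rw [hm] at hmin
  generalize Nat.find hex = n at hm e he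
  subst hm
  have hsub : ∀ p : Fin (m + 1), LinearIndependent ℝ fun j => v (e (p.succAbove j)) := fun p =>
    hmin m (Nat.lt_succ_self m) ((Fin.succAboveEmb p).trans e)
  rw [Fintype.linearIndependent_iff] at he
  push Not at he
  obtain ⟨c, hc, j₀, hj₀⟩ := he
  refine ⟨m, e, c, fun p hp => hj₀ ?_, hc, hsub⟩
  rw [Fin.sum_univ_succAbove _ p, hp, zero_smul, zero_add] at hc
  have h1 := Fintype.linearIndependent_iff.1 (hsub p) _ hc
  rcases eq_or_ne j₀ p with rfl | hne
  · exact hp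
  · obtain ⟨j, rfl⟩ := Fin.exists_succAbove_eq hne
    exact h1 j

theorem span_circuit {V : Type*} [AddCommGroup V] [Module ℝ V] {m : ℕ} {v : Fin (m + 1) → V}
    {c : Fin (m + 1) → ℝ} (hc : ∀ j, c j ≠ 0) (hsum : ∑ j, c j • v j = 0) (p : Fin (m + 1)) :
    v p = ∑ j, (-(c p)⁻¹ * c (p.succAbove j)) • v (p.succAbove j) ∧
    Submodule.span ℝ (Set.range v) = Submodule.span ℝ (Set.range fun j => v (p.succAbove j)) := by
  have h1 : v p = ∑ j, (-(c p)⁻¹ * c (p.succAbove j)) • v (p.succAbove j) := by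
    rw [Fin.sum_univ_succAbove _ p] at hsum
    simp only [mul_smul, ← Finset.smul_sum]
    rw [eq_neg_of_add_eq_zero_right hsum, smul_neg, neg_smul, neg_neg, inv_smul_smul₀ (hc p)]
  refine ⟨h1, le_antisymm ?_ ?_⟩
  · rw [Submodule.span_le]
    rintro _ ⟨j, rfl⟩
    rcases eq_or_ne j p with rfl | hne
    · rw [SetLike.mem_coe, h1]
      exact Submodule.sum_mem _ fun j _ =>
        Submodule.smul_mem _ _ (Submodule.subset_span ⟨j, rfl⟩)
    · obtain ⟨j, rfl⟩ := Fin.exists_succAbove_eq hne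
      exact Submodule.subset_span ⟨j, rfl⟩
  · exact Submodule.span_mono (Set.range_comp_subset_range p.succAbove v)

/-- If some `d i` is outside `U`, every other `d j` lies in `U ⊔ span {d i}`; by the modular law the
span of `d` is then its intersection with `U` plus at most one dimension. -/
theorem card_le_of_pairwise_dependent {V ι : Type*} [AddCommGroup V] [Module ℝ V]
    [FiniteDimensional ℝ V] [Fintype ι] {U : Submodule ℝ V} {d : ι → V}
    (hd : LinearIndependent ℝ d)
    (h : ∀ i j, i ≠ j → d i ∈ U ∨ d j ∈ U ⊔ Submodule.span ℝ {d i}) :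
    Fintype.card ι ≤ Module.finrank ℝ (U ⊓ Submodule.span ℝ (Set.range d) : Submodule ℝ V) + 1 := by
  rw [← finrank_span_eq_card hd]
  by_cases hall : ∀ i, d i ∈ U
  · have : Submodule.span ℝ (Set.range d) ≤ U := by
      rw [Submodule.span_le]
      rintro _ ⟨i, rfl⟩
      exact hall i
    rw [inf_eq_right.2 this]
    exact Nat.le_succ _
  · push Not at hall
    obtain ⟨i, hi⟩ := hall
    have h1 : Submodule.span ℝ (Set.range d) ≤ Submodule.span ℝ {d i} ⊔ U := by
      rw [Submodule.span_le, sup_comm]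
      rintro _ ⟨j, rfl⟩
      rcases eq_or_ne i j with rfl | hne
      · exact Submodule.mem_sup_right (Submodule.mem_span_singleton_self _)
      · exact (h i j hne).resolve_left hi
    have h2 : Submodule.span ℝ {d i} ≤ Submodule.span ℝ (Set.range d) :=
      Submodule.span_mono (by simp)
    have h3 : Submodule.span ℝ (Set.range d) =
        Submodule.span ℝ {d i} ⊔ U ⊓ Submodule.span ℝ (Set.range d) := by
      rw [← sup_inf_assoc_of_le _ h2, inf_eq_right.2 h1]
    calc Module.finrank ℝ (Submodule.span ℝ (Set.range d))
        ≤ Module.finrank ℝ (Submodule.span ℝ {d i}) +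
          Module.finrank ℝ (U ⊓ Submodule.span ℝ (Set.range d) : Submodule ℝ V) := by
          conv_lhs => rw [h3]
          exact Submodule.finrank_add_le_finrank_add_finrank _ _
      _ ≤ _ := by
          have : Module.finrank ℝ (Submodule.span ℝ {d i}) ≤ 1 := by
            simpa using finrank_span_le_card (R := ℝ) ({d i} : Set V)
          omega

/-- If the second blocks of the vectors in `U` span a space of dimension `a`, then `U` meets the
vectors with vanishing second block in codimension at least `a`. -/
theorem finrank_inf_add_card_le {V E α : Type*} [AddCommGroup V] [Module ℝ V]
    [FiniteDimensional ℝ V] [AddCommGroup E] [Module ℝ E] [FiniteDimensional ℝ E] [Fintype α]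
    (U D : Submodule ℝ V) (π : V →ₗ[ℝ] E) (hD : D ≤ π.ker) {u : α → V} (hu : ∀ a, u a ∈ U)
    (hli : LinearIndependent ℝ fun a => π (u a)) :
    Module.finrank ℝ (U ⊓ D : Submodule ℝ V) + Fintype.card α ≤ Module.finrank ℝ U := by
  let u' : α → U := fun a => ⟨u a, hu a⟩
  have h1 : LinearIndependent ℝ fun a =>
      (⟨π.domRestrict U (u' a), u' a, rfl⟩ : (π.domRestrict U).range) :=
    LinearIndependent.of_comp (Submodule.subtype _) hli
  have h2 := h1.fintype_card_le_finrank
  have h3 := LinearMap.finrank_range_add_finrank_ker (π.domRestrict U)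
  have h4 : Module.finrank ℝ (U ⊓ D : Submodule ℝ V) ≤ Module.finrank ℝ (π.domRestrict U).ker := by
    rw [← Submodule.finrank_map_subtype_eq U (π.domRestrict U).ker]
    apply Submodule.finrank_mono
    rintro x ⟨hxU, hxD⟩
    exact ⟨⟨x, hxU⟩, hD hxD, rfl⟩
  omega

/-! ### Spike conditions as linear equations, and generic parameters. -/

variable {I J K : ℕ}

/-- The integral condition on the first `a.2 + 1` spikes of the machine `a.1`, where the last of
these is at time `t`, is linear in the coefficients and the thresholds. This is its left side. -/
def spikeRow (K : ℕ) (Ω s₀ : ℝ) (A : Matrix (Fin I) (Fin J) ℝ) (κ t₀ : Fin I → ℝ)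
    (a : Fin I × ℕ) (t : ℝ) : (Fin J × Fin K) ⊕ Fin I → ℝ :=
  Sum.elim (rankOne A a.1 (sincPrim K Ω s₀ (t₀ a.1) t))
    (Pi.single a.1 (-(2 * κ a.1 * ((a.2 : ℝ) + 1))))

/-- The derivative of `spikeRow` in the spike time. -/
def spikeRowDeriv (K : ℕ) (Ω s₀ : ℝ) (A : Matrix (Fin I) (Fin J) ℝ) (i : Fin I) (t : ℝ) :
    (Fin J × Fin K) ⊕ Fin I → ℝ :=
  Sum.elim (rankOne A i (sincVec K Ω s₀ t)) 0

/-- The right side of the integral condition on the first spikes of a machine. -/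
def spikeRhs (b t₀ : Fin I → ℝ) (a : Fin I × ℕ) (t : ℝ) : ℝ := -(b a.1 * (t - t₀ a.1))

/-- The vector `w` of coefficients and thresholds is compatible with a spike at time `t`. -/
def HasSpike (Ω s₀ : ℝ) (A : Matrix (Fin I) (Fin J) ℝ) (κ b t₀ : Fin I → ℝ)
    (w : (Fin J × Fin K) ⊕ Fin I → ℝ) (a : Fin I × ℕ) (t : ℝ) : Prop :=
  ∑ x, spikeRow K Ω s₀ A κ t₀ a t x * w x = spikeRhs b t₀ a t

theorem hasDerivAt_spikeRow (Ω s₀ : ℝ) (A : Matrix (Fin I) (Fin J) ℝ) (κ t₀ : Fin I → ℝ)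
    (a : Fin I × ℕ) (t : ℝ) :
    HasDerivAt (spikeRow K Ω s₀ A κ t₀ a) (spikeRowDeriv K Ω s₀ A a.1 t) t := by
  rw [hasDerivAt_pi]
  rintro (p | i)
  · exact ((hasDerivAt_pi.1 (hasDerivAt_sincPrim K Ω s₀ (t₀ a.1) t)) p.2).const_mul (A a.1 p.1)
  · exact hasDerivAt_const _ _

theorem continuous_spikeRowDeriv (Ω s₀ : ℝ) (A : Matrix (Fin I) (Fin J) ℝ) (i : Fin I) :
    Continuous (spikeRowDeriv K Ω s₀ A i) := by
  refine continuous_pi ?_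
  rintro (p | i')
  · exact continuous_const.mul ((continuous_apply p.2).comp (continuous_sincVec K Ω s₀))
  · exact continuous_const

theorem differentiable_spikeRow (Ω s₀ : ℝ) (A : Matrix (Fin I) (Fin J) ℝ) (κ t₀ : Fin I → ℝ)
    {n : ℕ} (Q : Fin n → Fin I × ℕ) (j : Fin n) (x : (Fin J × Fin K) ⊕ Fin I) :
    Differentiable ℝ fun s : Fin n → ℝ => spikeRow K Ω s₀ A κ t₀ (Q j) (s j) x := by
  have h : Differentiable ℝ fun t => spikeRow K Ω s₀ A κ t₀ (Q j) t x := fun t =>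
    (hasDerivAt_pi.1 (hasDerivAt_spikeRow Ω s₀ A κ t₀ (Q j) t) x).differentiableAt
  exact h.comp (differentiable_apply j)

theorem differentiable_spikeRhs (b t₀ : Fin I → ℝ) {n : ℕ} (Q : Fin n → Fin I × ℕ) (j : Fin n) :
    Differentiable ℝ fun s : Fin n → ℝ => spikeRhs b t₀ (Q j) (s j) := by
  unfold spikeRhs
  fun_prop

theorem spikeRow_ne_zero (Ω s₀ : ℝ) (A : Matrix (Fin I) (Fin J) ℝ) {κ : Fin I → ℝ}
    (hκ : ∀ i, 0 < κ i) (t₀ : Fin I → ℝ) (a : Fin I × ℕ) (t : ℝ) :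
    spikeRow K Ω s₀ A κ t₀ a t ≠ 0 := by
  intro h
  have h1 := congrFun h (Sum.inr a.1)
  simp only [spikeRow, Sum.elim_inr, Pi.single_eq_same, Pi.zero_apply, neg_eq_zero] at h1
  have h2 : 0 < 2 * κ a.1 * ((a.2 : ℝ) + 1) := mul_pos (mul_pos two_pos (hκ a.1)) (by positivity)
  exact h2.ne' h1

/-- If the spike times are confined to a null set and the integral conditions are independent,
then the vector of coefficients and thresholds is confined to a null set. -/
theorem volume_hasSpike_eq_zero (Ω s₀ : ℝ) (A : Matrix (Fin I) (Fin J) ℝ) (κ b t₀ : Fin I → ℝ)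
    {n : ℕ} (Q : Fin n → Fin I × ℕ) {W : Set (Fin n → ℝ)} (hW : volume W = 0) :
    ∀ᵐ w : (Fin J × Fin K) ⊕ Fin I → ℝ, ∀ s : Fin n → ℝ,
      LinearIndependent ℝ (fun j => spikeRow K Ω s₀ A κ t₀ (Q j) (s j)) →
      (∀ j, HasSpike Ω s₀ A κ b t₀ w (Q j) (s j)) → s ∉ W := by
  have h := volume_solutions_eq_zero (P := fun s j => spikeRow K Ω s₀ A κ t₀ (Q j) (s j))
    (β := fun s j => spikeRhs b t₀ (Q j) (s j)) (differentiable_spikeRow Ω s₀ A κ t₀ Q)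
    (differentiable_spikeRhs b t₀ Q) hW
  refine measure_mono_null ?_ h
  intro w hw
  simp only [Set.mem_compl_iff, Set.mem_ofPred_eq] at hw
  push Not at hw
  obtain ⟨s, h1, h2, h3⟩ := hw
  exact ⟨s, h3, h1, h2⟩

/-- What almost all vectors of coefficients and thresholds satisfy. -/
structure IsGeneric (Ω s₀ : ℝ) (A : Matrix (Fin I) (Fin J) ℝ) (κ b t₀ : Fin I → ℝ)
    (w : (Fin J × Fin K) ⊕ Fin I → ℝ) : Prop where
  notMem_lattice : ∀ a t, HasSpike Ω s₀ A κ b t₀ w a t → t ∉ lattice Ω s₀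
  linearIndependent_prim : ∀ (q : ℕ) (Q : Fin q → Fin I × ℕ), q ≤ J * K →
    (∀ i, (Finset.univ.filter fun j => (Q j).1 = i).card ≤ K) → ∀ s : Fin q → ℝ,
    LinearIndependent ℝ (fun j => spikeRow K Ω s₀ A κ t₀ (Q j) (s j)) →
    (∀ j, HasSpike Ω s₀ A κ b t₀ w (Q j) (s j)) →
    LinearIndependent ℝ fun j =>
      (rankOne A (Q j).1 (sincPrim K Ω s₀ (t₀ (Q j).1) (s j)) : Fin J × Fin K → ℝ)
  linearIndependent_vec : ∀ (q : ℕ) (Q : Fin q → Fin I × ℕ), q ≤ J * K →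
    (∀ i, (Finset.univ.filter fun j => (Q j).1 = i).card ≤ K) → ∀ s : Fin q → ℝ,
    LinearIndependent ℝ (fun j => spikeRow K Ω s₀ A κ t₀ (Q j) (s j)) →
    (∀ j, HasSpike Ω s₀ A κ b t₀ w (Q j) (s j)) →
    LinearIndependent ℝ fun j => (rankOne A (Q j).1 (sincVec K Ω s₀ (s j)) : Fin J × Fin K → ℝ)
  not_coincidence : ∀ (r : ℕ) (Q : Fin (r + 1) → Fin I × ℕ) (p : Fin (r + 1)) (a : Fin I × ℕ)
    (s : Fin (r + 1) → ℝ), LinearIndependent ℝ (fun j => spikeRow K Ω s₀ A κ t₀ (Q j) (s j)) →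
    (∀ j, HasSpike Ω s₀ A κ b t₀ w (Q j) (s j)) → ∀ (v : ℝ) (m : Fin (r + 1) → ℝ), m p ≠ 0 →
    spikeRow K Ω s₀ A κ t₀ a v = ∑ j, m j • spikeRow K Ω s₀ A κ t₀ (Q j) (s j) →
    ¬ LinearIndependent ℝ (Fin.snoc
      (Fin.snoc (fun j => spikeRow K Ω s₀ A κ t₀ (Q j) (s j))
          (spikeRowDeriv K Ω s₀ A (Q p).1 (s p)) :
        Fin (r + 2) → (Fin J × Fin K) ⊕ Fin I → ℝ)
      (spikeRowDeriv K Ω s₀ A a.1 v) : Fin (r + 3) → (Fin J × Fin K) ⊕ Fin I → ℝ)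

/-- The spike labels range over countable sets, so each condition may be checked for fixed labels,
where it says that spike times with independent rows avoid a fixed null set. -/
theorem ae_isGeneric {Ω s₀ : ℝ} (hΩ : 0 < Ω) {A : Matrix (Fin I) (Fin J) ℝ} (hIJ : J ≤ I)
    (hA : ∀ r : Fin J ↪ Fin I, LinearIndependent ℝ (fun j => A.row (r j)))
    {κ : Fin I → ℝ} (hκ : ∀ i, 0 < κ i) (b t₀ : Fin I → ℝ) :
    ∀ᵐ w : (Fin J × Fin K) ⊕ Fin I → ℝ, IsGeneric Ω s₀ A κ b t₀ w := by
  have h1 : ∀ᵐ w : (Fin J × Fin K) ⊕ Fin I → ℝ, ∀ a, ∀ t ∈ lattice Ω s₀,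
      ¬ HasSpike Ω s₀ A κ b t₀ w a t := by
    rw [ae_all_iff]
    intro a
    rw [ae_ball_iff (countable_lattice hΩ s₀)]
    intro t ht
    have h := volume_hasSpike_eq_zero (K := K) Ω s₀ A κ b t₀ (fun _ : Fin 1 => a)
      (W := {fun _ => t}) (measure_singleton _)
    filter_upwards [h] with w hw hs
    exact hw (fun _ => t)
      (linearIndependent_unique_iff.2 (spikeRow_ne_zero Ω s₀ A hκ t₀ a t))
      (fun _ => hs) rfl
  have h2 : ∀ᵐ w : (Fin J × Fin K) ⊕ Fin I → ℝ, ∀ (q : ℕ) (Q : Fin q → Fin I × ℕ), q ≤ J * K →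
      (∀ i, (Finset.univ.filter fun j => (Q j).1 = i).card ≤ K) → ∀ s : Fin q → ℝ,
      LinearIndependent ℝ (fun j => spikeRow K Ω s₀ A κ t₀ (Q j) (s j)) →
      (∀ j, HasSpike Ω s₀ A κ b t₀ w (Q j) (s j)) →
      LinearIndependent ℝ fun j =>
        (rankOne A (Q j).1 (sincPrim K Ω s₀ (t₀ (Q j).1) (s j)) : Fin J × Fin K → ℝ) := by
    simp only [ae_all_iff]
    intro q Q hq hQ
    filter_upwards [volume_hasSpike_eq_zero (K := K) Ω s₀ A κ b t₀ Q
      (ae_linearIndependent_rankOne hIJ hA (fun j => (Q j).1) hq hQ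
        (g := fun j => sincPrim K Ω s₀ (t₀ (Q j).1)) (fun j => continuous_sincPrim K Ω s₀ _)
        (fun j ψ hψ => by
          simpa [ae_iff] using (countable_zeros_sincPrim hΩ s₀ (t₀ (Q j).1) hψ).measure_zero volume))]
      with w hw s h h'
    simpa using hw s h h'
  have h3 : ∀ᵐ w : (Fin J × Fin K) ⊕ Fin I → ℝ, ∀ (q : ℕ) (Q : Fin q → Fin I × ℕ), q ≤ J * K →
      (∀ i, (Finset.univ.filter fun j => (Q j).1 = i).card ≤ K) → ∀ s : Fin q → ℝ,
      LinearIndependent ℝ (fun j => spikeRow K Ω s₀ A κ t₀ (Q j) (s j)) →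
      (∀ j, HasSpike Ω s₀ A κ b t₀ w (Q j) (s j)) →
      LinearIndependent ℝ fun j =>
        (rankOne A (Q j).1 (sincVec K Ω s₀ (s j)) : Fin J × Fin K → ℝ) := by
    simp only [ae_all_iff]
    intro q Q hq hQ
    filter_upwards [volume_hasSpike_eq_zero (K := K) Ω s₀ A κ b t₀ Q
      (ae_linearIndependent_rankOne hIJ hA (fun j => (Q j).1) hq hQ
        (g := fun _ => sincVec K Ω s₀) (fun j => continuous_sincVec K Ω s₀)
        (fun j ψ hψ => by
          simpa [ae_iff] using (countable_zeros_sincVec hΩ s₀ hψ).measure_zero volume))]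
      with w hw s h h'
    simpa using hw s h h'
  have h4 : ∀ᵐ w : (Fin J × Fin K) ⊕ Fin I → ℝ, ∀ (r : ℕ) (Q : Fin (r + 1) → Fin I × ℕ)
      (p : Fin (r + 1)) (a : Fin I × ℕ)
      (s : Fin (r + 1) → ℝ), LinearIndependent ℝ (fun j => spikeRow K Ω s₀ A κ t₀ (Q j) (s j)) →
      (∀ j, HasSpike Ω s₀ A κ b t₀ w (Q j) (s j)) →
      s ∉ {s | ∃ (v : ℝ) (m : Fin (r + 1) → ℝ), m p ≠ 0 ∧
      LinearIndependent ℝ (Fin.snoc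
        (Fin.snoc (fun j => spikeRow K Ω s₀ A κ t₀ (Q j) (s j))
          (spikeRowDeriv K Ω s₀ A (Q p).1 (s p)) :
          Fin (r + 2) → (Fin J × Fin K) ⊕ Fin I → ℝ)
        (spikeRowDeriv K Ω s₀ A a.1 v) : Fin (r + 3) → (Fin J × Fin K) ⊕ Fin I → ℝ) ∧
      spikeRow K Ω s₀ A κ t₀ a v = ∑ j, m j • spikeRow K Ω s₀ A κ t₀ (Q j) (s j)} := by
    simp only [ae_all_iff]
    intro r Q p a
    have hder := hasDerivAt_spikeRow (K := K) Ω s₀ A κ t₀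
    have hcont := continuous_spikeRowDeriv (K := K) Ω s₀ A
    have := volume_hasSpike_eq_zero (K := K) Ω s₀ A κ b t₀ Q
      (volume_coincidence_eq_zero p (R := fun j => spikeRow K Ω s₀ A κ t₀ (Q j))
        (fun j => continuous_iff_continuousAt.2 fun t => (hder (Q j) t).continuousAt)
        (hder (Q p)) (hcont _) (hder a) (hcont _))
    simpa only [ae_all_iff] using this
  filter_upwards [h1, h2, h3, h4] with w w1 w2 w3 w4
  refine ⟨fun a t ht htl => w1 a t htl ht, w2, w3, ?_⟩
  intro r Q p a s hs hs' v m hm hv hli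
  exact w4 r Q p a s hs hs' ⟨v, m, hm, hli, hv⟩

theorem card_filter_comp_le {α : Type*} [DecidableEq α] {m q K : ℕ} (e : Fin m ↪ Fin q)
    {i : Fin q → α} (hi : ∀ a, (Finset.univ.filter fun j => i j = a).card ≤ K) (a : α) :
    (Finset.univ.filter fun j => i (e j) = a).card ≤ K := by
  refine (Finset.card_le_card_of_injOn e ?_ e.injective.injOn).trans (hi a)
  intro j hj
  simpa using hj

/-- For a generic vector of coefficients and thresholds, up to `J K` distinct spikes, with at most
`K` of each machine, give linearly independent conditions on the coefficients. -/
theorem IsGeneric.linearIndependent {Ω s₀ : ℝ} (hΩ : 0 < Ω) {A : Matrix (Fin I) (Fin J) ℝ}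
    (hIJ : J ≤ I) (hA : ∀ r : Fin J ↪ Fin I, LinearIndependent ℝ (fun j => A.row (r j)))
    {κ : Fin I → ℝ} (hκ : ∀ i, 0 < κ i) {b t₀ : Fin I → ℝ} {w : (Fin J × Fin K) ⊕ Fin I → ℝ}
    (hw : IsGeneric Ω s₀ A κ b t₀ w) {q : ℕ} {Q : Fin q → Fin I × ℕ} (hq : q ≤ J * K)
    (hQ : ∀ i, (Finset.univ.filter fun j => (Q j).1 = i).card ≤ K) {s : Fin q → ℝ}
    (hs : ∀ j, HasSpike Ω s₀ A κ b t₀ w (Q j) (s j))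
    (hdist : ∀ j j', (Q j).1 = (Q j').1 → s j = s j' → j = j') :
    LinearIndependent ℝ fun j =>
      (rankOne A (Q j).1 (sincPrim K Ω s₀ (t₀ (Q j).1) (s j)) : Fin J × Fin K → ℝ) := by
  refine hw.linearIndependent_prim q Q hq hQ s ?_ hs
  by_contra hdep
  obtain ⟨m, e, c, hc, hsum, hsub⟩ := exists_circuit hdep
  have hmq : m + 1 ≤ q := by simpa using Fintype.card_le_of_embedding e
  set v : Fin (m + 1) → (Fin J × Fin K) ⊕ Fin I → ℝ :=
    fun j => spikeRow K Ω s₀ A κ t₀ (Q (e j)) (s (e j)) with hv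
  set d : Fin (m + 1) → (Fin J × Fin K) ⊕ Fin I → ℝ :=
    fun j => spikeRowDeriv K Ω s₀ A (Q (e j)).1 (s (e j)) with hd
  set U := Submodule.span ℝ (Set.range v) with hU
  have hspan := span_circuit hc hsum
  have hUrank : Module.finrank ℝ U = m := by
    rw [hU, (hspan 0).2, finrank_span_eq_card (hsub 0), Fintype.card_fin]
  -- Apply genericity to the family without `p'`: all coefficients of a minimal relation are
  -- nonzero, so row `p'` is a combination of the others in which row `p` really occurs.
  have hpair : ∀ p p', p ≠ p' → d p ∈ U ∨ d p' ∈ U ⊔ Submodule.span ℝ {d p} := by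
    intro p p' hne
    obtain ⟨pp, rfl⟩ := Fin.exists_succAbove_eq hne
    obtain ⟨r, rfl⟩ : ∃ r, m = r + 1 := Nat.exists_eq_succ_of_ne_zero fun h => by
      subst h; exact pp.elim0
    have h1 := hw.not_coincidence r (fun j => Q (e (p'.succAbove j))) pp (Q (e p'))
      (fun j => s (e (p'.succAbove j))) (hsub p') (fun j => hs _) (s (e p'))
      (fun j => -(c p')⁻¹ * c (p'.succAbove j))
      (mul_ne_zero (neg_ne_zero.2 (inv_ne_zero (hc _))) (hc _)) (hspan p').1
    rw [linearIndependent_finSnoc, linearIndependent_finSnoc] at h1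
    have hR : Submodule.span ℝ (Set.range fun j => spikeRow K Ω s₀ A κ t₀ (Q (e (p'.succAbove j)))
        (s (e (p'.succAbove j)))) = U := (hspan p').2.symm
    rw [Fin.range_snoc, Submodule.span_insert, hR] at h1
    by_contra hcon
    push Not at hcon
    exact h1 ⟨⟨hsub p', hcon.1⟩, sup_comm U _ ▸ hcon.2⟩
  let π : ((Fin J × Fin K) ⊕ Fin I → ℝ) →ₗ[ℝ] (Fin I → ℝ) := LinearMap.funLeft ℝ ℝ Sum.inr
  let π' : ((Fin J × Fin K) ⊕ Fin I → ℝ) →ₗ[ℝ] (Fin J × Fin K → ℝ) :=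
    LinearMap.funLeft ℝ ℝ Sum.inl
  have hπd : ∀ {α : Type} (f : α → Fin (m + 1)),
      Submodule.span ℝ (Set.range fun x => d (f x)) ≤ LinearMap.ker π := by
    intro α f
    rw [Submodule.span_le]
    rintro _ ⟨x, rfl⟩
    rfl
  have hvU : ∀ j, v j ∈ U := fun j => Submodule.subset_span ⟨j, rfl⟩
  have hne : ∀ j, -(2 * κ (Q (e j)).1 * (((Q (e j)).2 : ℝ) + 1)) ≠ 0 := fun j =>
    neg_ne_zero.2 (mul_pos (mul_pos two_pos (hκ _)) (by positivity)).ne'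
  have hπv : ∀ j, π (v j) =
      Pi.single (Q (e j)).1 (-(2 * κ (Q (e j)).1 * (((Q (e j)).2 : ℝ) + 1))) := fun j => rfl
  -- With a single machine, genericity would only give `m` independent derivatives, one too few. The
  -- Cauchy matrix gives all `m + 1`, as the times are distinct and off the lattice.
  by_cases hone : ∀ j, (Q (e j)).1 = (Q (e 0)).1
  · have hdli : LinearIndependent ℝ d := by
      apply LinearIndependent.of_comp π'
      have hcard : Fintype.card (Fin (m + 1)) ≤ K := by
        have := card_filter_comp_le e hQ (Q (e 0)).1
        rw [Finset.filter_true_of_mem fun j _ => hone j] at this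
        simpa using this
      have hvec := linearIndependent_sincVec hcard hΩ (s₀ := s₀) (t := fun j => s (e j))
        (fun j j' h => e.injective (hdist _ _ ((hone j).trans (hone j').symm) h))
        (fun j => hw.notMem_lattice _ _ (hs (e j)))
      have hJ : 1 ≤ J := by
        rcases Nat.eq_zero_or_pos J with rfl | h
        · simp at hq; omega
        · exact h
      have hrow := linearIndependent_rows_of_card_le hIJ hA (s := {(Q (e 0)).1}) (by simpa using hJ)
      have hrow0 : A.row (Q (e 0)).1 ≠ 0 := hrow.ne_zero ⟨_, Finset.mem_singleton_self _⟩
      obtain ⟨a, ha⟩ := Function.ne_iff.1 hrow0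
      have hker : LinearMap.ker (rankOne A (Q (e 0)).1 : (Fin K → ℝ) →ₗ[ℝ] (Fin J × Fin K → ℝ))
          = ⊥ := by
        rw [LinearMap.ker_eq_bot']
        intro x hx
        ext k
        exact (mul_eq_zero.1 (congrFun hx (a, k))).resolve_left ha
      have := hvec.map' _ hker
      have h3 : π' ∘ d = rankOne A (Q (e 0)).1 ∘ fun j => sincVec K Ω s₀ (s (e j)) := by
        funext j
        change rankOne A (Q (e j)).1 (sincVec K Ω s₀ (s (e j))) = _
        rw [hone j]
        rfl
      rw [h3]
      exact this
    have h1 := card_le_of_pairwise_dependent hdli hpair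
    have h2 := finrank_inf_add_card_le U (Submodule.span ℝ (Set.range d)) π (hπd id)
      (u := fun _ : Fin 1 => v 0) (fun _ => hvU 0) (linearIndependent_unique_iff.2 (by
        rw [hπv]
        simpa using hne 0))
    rw [hUrank] at h2
    simp only [Fintype.card_fin] at h1 h2
    omega
  · push Not at hone
    obtain ⟨j₁, hj₁⟩ := hone
    have hdli : LinearIndependent ℝ fun j => d ((0 : Fin (m + 1)).succAbove j) := by
      apply LinearIndependent.of_comp π'
      exact hw.linearIndependent_vec m (fun j => Q (e ((0 : Fin (m + 1)).succAbove j))) (by omega)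
        (card_filter_comp_le ((Fin.succAboveEmb 0).trans e) hQ) _ (hsub 0) (fun j => hs _)
    -- Two machines contribute two independent threshold parts, so here `m` independent derivatives
    -- already contradict the bound `m - 1`.
    have h1 := card_le_of_pairwise_dependent hdli (U := U) (fun p p' hne => hpair _ _ fun h =>
      hne (Fin.succAbove_right_injective h))
    have h2 := finrank_inf_add_card_le U _ π (hπd (Fin.succAbove (0 : Fin (m + 1))))
      (u := ![v 0, v j₁]) (fun x => by fin_cases x <;> exact hvU _) (by
        have : (fun a => π ((![v 0, v j₁] : Fin 2 → _) a)) = ![π (v 0), π (v j₁)] := by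
          ext x; fin_cases x <;> rfl
        rw [this, LinearIndependent.pair_iff]
        intro x y hxy
        have hx := congrFun hxy (Q (e 0)).1
        have hy := congrFun hxy (Q (e j₁)).1
        simp only [hπv, Pi.add_apply, Pi.smul_apply, Pi.single_eq_same, smul_eq_mul,
          Pi.single_eq_of_ne hj₁, Pi.single_eq_of_ne hj₁.symm, mul_zero, add_zero, zero_add,
          Pi.zero_apply] at hx hy
        exact ⟨(mul_eq_zero.1 hx).resolve_right (hne 0), (mul_eq_zero.1 hy).resolve_right (hne j₁)⟩)
    rw [hUrank] at h2
    simp only [Fintype.card_fin] at h1 h2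
    omega

/-! ### Absolute continuity of the law of the coefficients. -/

/-- The function `L * x - cdf μ x` is nondecreasing, so its Stieltjes measure is the nonnegative
difference of the two sides. -/
theorem le_smul_volume_of_lipschitzWith_cdf {μ : Measure ℝ} [IsProbabilityMeasure μ] {L : NNReal}
    (h : LipschitzWith L (cdf μ)) : μ ≤ L • volume := by
  let G : StieltjesFunction ℝ :=
    { toFun := fun x => L * x - cdf μ x
      mono' := by
        intro x y hxy
        have h1 := h.dist_le_mul y x
        rw [Real.dist_eq, Real.dist_eq, abs_of_nonneg (sub_nonneg.2 hxy)] at h1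
        have h2 := (le_abs_self _).trans h1
        simp only
        linarith
      right_continuous' := fun x =>
        ((continuous_const.mul continuous_id).sub h.continuous).continuousWithinAt }
  have h1 : cdf μ + G = L • StieltjesFunction.id := by
    ext x
    change cdf μ x + (L * x - cdf μ x) = L * x
    ring
  have h2 : (cdf μ + G).measure = (L • StieltjesFunction.id : StieltjesFunction ℝ).measure := by
    rw [h1]
  rw [StieltjesFunction.measure_add, StieltjesFunction.measure_smul, measure_cdf,
    ← Real.volume_eq_stieltjes_id] at h2
  rw [← h2]
  exact Measure.le_add_right le_rfl

theorem pi_absolutelyContinuous_of_le_smul {ι : Type*} [Fintype ι] {μ : ι → Measure ℝ}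
    [∀ i, SigmaFinite (μ i)] {L : ι → NNReal} (h : ∀ i, μ i ≤ L i • volume) :
    Measure.pi μ ≪ (volume : Measure (ι → ℝ)) := by
  have h1 : Measure.pi μ ≤ Measure.pi fun i => L i • (volume : Measure ℝ) := by
    refine Measure.le_iff.2 fun s _ => ?_
    have h2 : (Measure.pi μ).toOuterMeasure ≤
        OuterMeasure.pi fun i => (L i • (volume : Measure ℝ)).toOuterMeasure := by
      rw [OuterMeasure.le_pi]
      intro s _
      rw [Measure.coe_toOuterMeasure, Measure.pi_pi]
      exact Finset.prod_le_prod' fun i _ => h i _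
    rw [Measure.pi_def (fun i => L i • (volume : Measure ℝ))]
    exact (h2 s).trans (le_toMeasure_apply _ _ _)
  have h3 : (Measure.pi fun i => L i • (volume : Measure ℝ)) =
      (∏ i, L i) • (volume : Measure (ι → ℝ)) := by
    refine Measure.pi_eq fun s _ => ?_
    rw [Measure.smul_apply, volume_pi_pi]
    simp only [Measure.smul_apply, ENNReal.smul_def, smul_eq_mul, Finset.prod_mul_distrib]
    push_cast
    rfl
  rw [h3] at h1
  exact (Measure.absolutelyContinuous_of_le h1).trans (Measure.smul_absolutelyContinuous)

/-- The joint law of independent random variables with Lipschitz distribution functions is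
absolutely continuous. -/
theorem map_absolutelyContinuous_volume {ι S : Type*} [Fintype ι] [MeasurableSpace S]
    {P : Measure S} [IsProbabilityMeasure P] {c : ι → S → ℝ} (hc : ∀ p, Measurable (c p))
    (hind : iIndepFun c P) (hL : ∀ p, ∃ L : NNReal, LipschitzWith L (cdf (P.map (c p)))) :
    P.map (fun ω p => c p ω) ≪ (volume : Measure (ι → ℝ)) := by
  rw [(iIndepFun_iff_map_fun_eq_pi_map fun p => (hc p).aemeasurable).1 hind]
  have : ∀ p, IsProbabilityMeasure (P.map (c p)) := fun p =>
    Measure.isProbabilityMeasure_map (hc p).aemeasurable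
  choose L hL using hL
  exact pi_absolutelyContinuous_of_le_smul fun p => le_smul_volume_of_lipschitzWith_cdf (hL p)

/-! ### From spike trains to recovery. -/

/-- The integral of the biased `i`-th mixture from `t₀` to `t`. -/
def integrator (Ω s₀ : ℝ) (A : Matrix (Fin I) (Fin J) ℝ) (b t₀ : Fin I → ℝ)
    (C : Matrix (Fin J) (Fin K) ℝ) (i : Fin I) (t : ℝ) : ℝ :=
  ∑ p : Fin J × Fin K, rankOne A i (sincPrim K Ω s₀ (t₀ i) t) p * C p.1 p.2 + b i * (t - t₀ i)

theorem mix_signal (Ω s₀ : ℝ) (A : Matrix (Fin I) (Fin J) ℝ) (C : Matrix (Fin J) (Fin K) ℝ)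
    (i : Fin I) (t : ℝ) : mix A (signal Ω s₀ C) i t =
      ∑ p : Fin J × Fin K, rankOne A i (sincVec K Ω s₀ t) p * C p.1 p.2 := by
  rw [Fintype.sum_prod_type]
  simp only [mix, signal, Finset.mul_sum]
  refine Finset.sum_congr rfl fun j _ => Finset.sum_congr rfl fun k _ => ?_
  simp only [rankOne, LinearMap.coe_mk, AddHom.coe_mk, sincVec, node]
  ring

theorem hasDerivAt_integrator (Ω s₀ : ℝ) (A : Matrix (Fin I) (Fin J) ℝ) (b t₀ : Fin I → ℝ)
    (C : Matrix (Fin J) (Fin K) ℝ) (i : Fin I) (t : ℝ) :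
    HasDerivAt (integrator Ω s₀ A b t₀ C i) (mix A (signal Ω s₀ C) i t + b i) t := by
  rw [mix_signal]
  refine HasDerivAt.add (HasDerivAt.fun_sum fun p _ => ?_) ?_
  · exact (((hasDerivAt_pi.1 (hasDerivAt_sincPrim K Ω s₀ (t₀ i) t)) p.2).const_mul
      (A i p.1)).mul_const _
  · simpa using ((hasDerivAt_id t).sub_const (t₀ i)).const_mul (b i)

theorem integral_mix_signal (Ω s₀ : ℝ) (A : Matrix (Fin I) (Fin J) ℝ) (b t₀ : Fin I → ℝ)
    (C : Matrix (Fin J) (Fin K) ℝ) (i : Fin I) (x y : ℝ) :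
    ∫ u in x..y, (mix A (signal Ω s₀ C) i u + b i) =
      integrator Ω s₀ A b t₀ C i y - integrator Ω s₀ A b t₀ C i x := by
  refine intervalIntegral.integral_eq_sub_of_hasDerivAt
    (fun t _ => hasDerivAt_integrator Ω s₀ A b t₀ C i t) (Continuous.intervalIntegrable ?_ _ _)
  simp only [mix_signal]
  refine Continuous.add (continuous_finsetSum _ fun p _ => ?_) continuous_const
  exact (continuous_const.mul
    ((continuous_apply p.2).comp (continuous_sincVec K Ω s₀))).mul continuous_const

/-- The integrals between consecutive spikes telescope. This uses only the recorded integrals, so it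
applies to a competing signal as well. -/
theorem integrator_apply_spike {Ω s₀ : ℝ} {A : Matrix (Fin I) (Fin J) ℝ} {b t₀ : Fin I → ℝ}
    {C : Matrix (Fin J) (Fin K) ℝ} {i : Fin I} {θ : ℝ} {n : ℕ} {t : ℕ → ℝ} (h0 : t 0 = t₀ i)
    (h : ∀ l < n, ∫ u in (t l)..(t (l + 1)), (mix A (signal Ω s₀ C) i u + b i) = θ) :
    ∀ l ≤ n, integrator Ω s₀ A b t₀ C i (t l) = l * θ := by
  intro l
  induction l with
  | zero =>
    intro _
    have : sincPrim K Ω s₀ (t₀ i) (t₀ i) = 0 := by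
      ext k
      simp [sincPrim]
    simp [integrator, h0, this]
  | succ l ih =>
    intro hl
    have h1 := h l hl
    rw [integral_mix_signal Ω s₀ A b t₀ C, ih (by omega)] at h1
    push_cast
    linarith

theorem EmitsSpikes.lt_of_lt {κ δ b t₀ : ℝ} {y : ℝ → ℝ} {n : ℕ} {t : ℕ → ℝ}
    (h : EmitsSpikes κ δ b t₀ y n t) {l l' : ℕ} (hl : l < l') (hl' : l' ≤ n) : t l < t l' := by
  induction l' with
  | zero => omega
  | succ m ih =>
    have h1 := (h.2 m hl').1
    rcases (Nat.lt_succ_iff.1 hl).eq_or_lt with rfl | h2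
    · exact h1
    · exact (ih h2 (by omega)).trans h1

theorem EmitsSpikes.eq_of_eq {κ δ b t₀ : ℝ} {y : ℝ → ℝ} {n : ℕ} {t : ℕ → ℝ}
    (h : EmitsSpikes κ δ b t₀ y n t) {l l' : ℕ} (hl : l ≤ n) (hl' : l' ≤ n) (heq : t l = t l') :
    l = l' := by
  rcases lt_trichotomy l l' with hlt | heq' | hlt
  · exact absurd heq (h.lt_of_lt hlt hl').ne
  · exact heq'
  · exact absurd heq.symm (h.lt_of_lt hlt hl).ne

/-- The label `(i, l)` stands for spike number `l + 1`, since number 0 is the starting time and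
carries no information. -/
theorem hasSpike_of_integrator_eq {Ω s₀ : ℝ} {A : Matrix (Fin I) (Fin J) ℝ}
    {κ δ b t₀ : Fin I → ℝ} {c : Fin J × Fin K → ℝ} {i : Fin I} {l : ℕ} {t : ℝ}
    (h : integrator Ω s₀ A b t₀ (Matrix.of fun j k => c (j, k)) i t
      = ((l + 1 : ℕ) : ℝ) * (2 * κ i * δ i)) :
    HasSpike Ω s₀ A κ b t₀ (Sum.elim c δ) (i, l) t := by
  unfold HasSpike spikeRhs
  unfold integrator at h
  simp only [Matrix.of_apply, Prod.mk.eta] at h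
  simp only [Fintype.sum_sum_type, spikeRow, Sum.elim_inl, Sum.elim_inr, Pi.single_apply, ite_mul,
    zero_mul, Finset.sum_ite_eq', Finset.mem_univ, if_true]
  push_cast at h
  linarith

/-- One can choose `J K` of the spikes, with at most `K` spikes of each machine. -/
theorem exists_spike_selection {n : Fin I → ℕ} (hn : J * K ≤ ∑ i, min (n i) K) :
    ∃ Q : Fin (J * K) → Fin I × ℕ, Function.Injective Q ∧ (∀ j, (Q j).2 < n (Q j).1) ∧
      ∀ i, (Finset.univ.filter fun j => (Q j).1 = i).card ≤ K := by
  let S : Finset (Fin I × ℕ) := Finset.univ.biUnion fun i =>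
    (Finset.range (min (n i) K)).map ⟨fun l => (i, l), Prod.mk_right_injective i⟩
  have hmem : ∀ x : Fin I × ℕ, x ∈ S ↔ x.2 < n x.1 ∧ x.2 < K := by
    rintro ⟨i, l⟩
    simp [S]
  have hcard : S.card = ∑ i, min (n i) K := by
    rw [Finset.card_biUnion]
    · simp
    · intro i _ i' _ hne
      rw [Function.onFun, Finset.disjoint_left]
      rintro ⟨a, l⟩ h1 h2
      simp only [Finset.mem_map, Function.Embedding.coeFn_mk, Prod.mk.injEq] at h1 h2
      obtain ⟨-, -, rfl, -⟩ := h1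
      obtain ⟨-, -, rfl, -⟩ := h2
      exact hne rfl
  obtain ⟨T, hTS, hT⟩ := Finset.exists_subset_card_eq (hcard ▸ hn)
  let e : Fin (J * K) ≃ T := (finCongr hT.symm).trans T.equivFin.symm
  have hinj : Function.Injective fun j => ((e j : T) : Fin I × ℕ) :=
    Subtype.val_injective.comp e.injective
  have hQ := fun j => (hmem _).1 (hTS (e j).2)
  refine ⟨fun j => e j, hinj, fun j => (hQ j).1, fun i => ?_⟩
  have : (Finset.univ.filter fun j => ((e j : T) : Fin I × ℕ).1 = i).card ≤
      (Finset.range K).card := by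
    refine Finset.card_le_card_of_injOn (fun j => ((e j : T) : Fin I × ℕ).2) ?_ ?_
    · intro j _
      simpa using (hQ j).2
    · intro j hj j' hj' h
      simp only [Finset.coe_filter, Finset.mem_univ, true_and, Set.mem_ofPred_eq] at hj hj'
      exact hinj (Prod.ext (hj.trans hj'.symm) h)
  simpa using this

theorem perfectlyRecoverable_of_isGeneric {Ω s₀ : ℝ} (hΩ : 0 < Ω) {A : Matrix (Fin I) (Fin J) ℝ}
    (hIJ : J ≤ I) (hA : ∀ r : Fin J ↪ Fin I, LinearIndependent ℝ (fun j => A.row (r j)))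
    {κ δ b t₀ : Fin I → ℝ} (hκ : ∀ i, 0 < κ i) {c : Fin J × Fin K → ℝ}
    (hw : IsGeneric Ω s₀ A κ b t₀ (Sum.elim c δ)) {n : Fin I → ℕ} {t : Fin I → ℕ → ℝ}
    (ht : ∀ i, EmitsSpikes (κ i) (δ i) (b i) (t₀ i)
      (mix A (signal Ω s₀ (Matrix.of fun (j : Fin J) (k : Fin K) => c (j, k))) i) (n i) (t i))
    (hn : J * K ≤ ∑ i, min (n i) K) :
    PerfectlyRecoverable Ω s₀ A κ δ b n t (Matrix.of fun (j : Fin J) (k : Fin K) => c (j, k)) := by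
  intro C' hC'
  obtain ⟨Q, hQinj, hQn, hQK⟩ := exists_spike_selection hn
  have hint := fun i => integrator_apply_spike (ht i).1 (fun l hl => ((ht i).2 l hl).2.1)
  have hint' := fun i => integrator_apply_spike (ht i).1 (hC' i)
  have hli := hw.linearIndependent hΩ hIJ hA hκ le_rfl hQK
    (s := fun j => t (Q j).1 ((Q j).2 + 1))
    (fun j => hasSpike_of_integrator_eq (hint _ _ (hQn j)))
    (fun j j' h1 h2 => by
      simp only [h1] at h2
      have hj := hQn j
      rw [h1] at hj
      have := (ht (Q j').1).eq_of_eq hj (hQn j') h2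
      exact hQinj (Prod.ext h1 (by omega)))
  have hspan := hli.span_eq_top_of_card_eq_finrank' (by simp)
  -- Pairing with the difference of the two coefficient matrices: bias and thresholds cancel, so it
  -- vanishes on the selected coefficient rows, which form a basis.
  let D : (Fin J × Fin K → ℝ) →ₗ[ℝ] ℝ := ∑ p, (C' p.1 p.2 - c p) • LinearMap.proj p
  have hD : D = 0 := by
    refine LinearMap.ext_on_range hspan fun j => ?_
    have h1 := hint (Q j).1 _ (hQn j)
    have h2 := hint' (Q j).1 _ (hQn j)
    unfold integrator at h1 h2
    simp only [Matrix.of_apply, Prod.mk.eta] at h1 h2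
    simp only [D, LinearMap.sum_apply, LinearMap.smul_apply, LinearMap.proj_apply, smul_eq_mul,
      LinearMap.zero_apply, sub_mul, Finset.sum_sub_distrib]
    simp only [mul_comm (C' _ _), mul_comm (c _)]
    linarith
  congr 1
  ext j k
  have h1 := LinearMap.congr_fun hD (Pi.single (j, k) 1)
  simp only [D, LinearMap.sum_apply, LinearMap.smul_apply, LinearMap.proj_apply, smul_eq_mul,
    LinearMap.zero_apply, Pi.single_apply, mul_ite, mul_one, mul_zero, Finset.sum_ite_eq',
    Finset.mem_univ, if_true] at h1
  exact sub_eq_zero.1 h1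

theorem signal_eq_of_mul_eq_zero (h : J * K = 0) (Ω s₀ : ℝ) (C C' : Matrix (Fin J) (Fin K) ℝ) :
    signal Ω s₀ C' = signal Ω s₀ C := by
  rcases mul_eq_zero.1 h with rfl | rfl
  · exact funext fun j => j.elim0
  · rfl

/-- For `I < J` the hypothesis on the rows of `A` is vacuous, but then the spike counts cannot reach
`J * K`. -/
theorem le_of_mul_le_sum_min {n : Fin I → ℕ} (h : J * K ≠ 0) (hn : J * K ≤ ∑ i, min (n i) K) :
    J ≤ I := by
  have h1 : ∑ i, min (n i) K ≤ I * K := by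
    simpa using Finset.sum_le_card_nsmul Finset.univ (fun i => min (n i) K) K
      fun i _ => min_le_right _ _
  exact Nat.le_of_mul_le_mul_right (hn.trans h1) (Nat.pos_of_ne_zero (right_ne_zero_of_mul h))

/-- Fubini with the thresholds as outer variable: the exceptional null set of thresholds does not
depend on the law of the coefficients. -/
theorem ae_ae_isGeneric {Ω s₀ : ℝ} (hΩ : 0 < Ω) {A : Matrix (Fin I) (Fin J) ℝ} (hIJ : J ≤ I)
    (hA : ∀ r : Fin J ↪ Fin I, LinearIndependent ℝ (fun j => A.row (r j)))
    {κ : Fin I → ℝ} (hκ : ∀ i, 0 < κ i) (b t₀ : Fin I → ℝ) :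
    ∀ᵐ δ : Fin I → ℝ, ∀ᵐ c : Fin J × Fin K → ℝ, IsGeneric Ω s₀ A κ b t₀ (Sum.elim c δ) := by
  have hmp := (volume_measurePreserving_sumPiEquivProdPi_symm
    (fun _ : (Fin J × Fin K) ⊕ Fin I => ℝ)).comp (Measure.measurePreserving_swap
      (μ := (volume : Measure (Fin I → ℝ))) (ν := (volume : Measure (Fin J × Fin K → ℝ))))
  have h := hmp.quasiMeasurePreserving.ae (ae_isGeneric (K := K) (s₀ := s₀) hΩ hIJ hA hκ b t₀)
  have h' := Measure.ae_ae_of_ae_prod h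
  filter_upwards [h'] with δ hδ
  filter_upwards [hδ] with c hc
  convert hc using 1
  ext x
  rcases x with p | i <;> rfl

end MixedTEM

end

theorem mainTheorem2 {I J K : ℕ} (Ω s₀ : ℝ) (hΩ : 0 < Ω)
    (A : Matrix (Fin I) (Fin J) ℝ)
    (hA : ∀ r : Fin J ↪ Fin I, LinearIndependent ℝ (fun j => A.row (r j)))
    (κ b t₀ : Fin I → ℝ) (hκ : ∀ i, 0 < κ i) :
    ∀ᵐ δ : Fin I → ℝ, (∀ i, 0 < δ i) →
      ∀ (S : Type*) [MeasurableSpace S] (P : Measure S) [IsProbabilityMeasure P]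
        (c : Fin J × Fin K → S → ℝ),
        (∀ p, Measurable (c p)) →
        iIndepFun c P →
        (∀ p, ∃ L : NNReal, LipschitzWith L (cdf (P.map (c p)))) →
        ∀ᵐ ω ∂P, ∀ (n : Fin I → ℕ) (t : Fin I → ℕ → ℝ),
          (∀ i, MixedTEM.EmitsSpikes (κ i) (δ i) (b i) (t₀ i)
            (MixedTEM.mix A
              (MixedTEM.signal Ω s₀ (Matrix.of fun (j : Fin J) (k : Fin K) => c (j, k) ω)) i)
            (n i) (t i)) →
          J * K ≤ ∑ i, min (n i) K →
          MixedTEM.PerfectlyRecoverable Ω s₀ A κ δ b n t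
            (Matrix.of fun (j : Fin J) (k : Fin K) => c (j, k) ω) := by
  by_cases hJK : J * K = 0
  · refine Filter.Eventually.of_forall fun δ _ S _ P _ c _ _ _ => ?_
    exact Filter.Eventually.of_forall fun ω n t _ _ C' _ =>
      MixedTEM.signal_eq_of_mul_eq_zero hJK Ω s₀ _ C'
  by_cases hIJ : J ≤ I
  · filter_upwards [MixedTEM.ae_ae_isGeneric (K := K) (s₀ := s₀) hΩ hIJ hA hκ b t₀] with δ hδ
    intro _ S _ P _ c hc hind hL
    have h1 := (MixedTEM.map_absolutelyContinuous_volume hc hind hL).ae_le hδ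
    have h2 := ae_of_ae_map (measurable_pi_lambda _ hc).aemeasurable h1
    filter_upwards [h2] with ω hω n t ht hn
    exact MixedTEM.perfectlyRecoverable_of_isGeneric hΩ hIJ hA hκ hω ht hn
  · refine Filter.Eventually.of_forall fun δ _ S _ P _ c _ _ _ => ?_
    exact Filter.Eventually.of_forall fun ω n t _ hn =>
      absurd (MixedTEM.le_of_mul_le_sum_min hJK hn) hIJ
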